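/- **Proposition (duplication principle).** Identify $\mathbb R^2$ with $\mathbb C$. Let $\mathbf D\subset\mathbb C$ be a bounded simply connected domain which is the interior of its closure, $\mathbf D=\mathrm{Int}(\overline{\mathbf D})$ (no slits). Assume that there are points $z\neq w$ such that $\partial\mathbf D\cap(z,w)=[z,w]$, where $(z,w)$ is the infinite line through $z,w$ and $[z,w]$ is the closed segment. Let $\mathtt S$ be the orthogonal reflection through this line and put $$\mathbf D^\star=\mathrm{Int}\big(\overline{\mathbf D}\cup\overline{\mathtt S(\mathbf D)}\big).$$ For $f:\mathbf D\to\mathbb R$ define its odd reflection $f^\#:\mathbf D^\star\to\mathbb R$ by $f^\#(x)=f(x)$ for $x\in\mathbf D$, $f^\#(x)=-f(\mathtt Sx)$ for $x\in\mathtt S(\mathbf D)$ (and $0$ on the remaining part of $\mathbf D^\star$, a null subset of the axis). For a bounded open set $\Omega$, let $L^\infty_c(\Omega)$ be the space of essentially bounded functions on $\Omega$ vanishing a.e. outside some compact subset of $\Omega$. Let $L^\infty(\mathbb R;L^\infty_c(\Omega))$ be the space of measurable, essentially bounded functions $\omega$ on $\mathbb R\times\Omega$ such that $\omega(t)=\omega(t,\cdot)\in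 L^\infty_c(\Omega)$ for a.e. $t$. Let $\psi=\Delta_\Omega^{-1}\omega$ be the weak solution $\psi\in H^1_0(\Omega)$ of $\Delta\psi=\omega$ in $\Omega$. Given $\omega_0\in L^\infty_c(\Omega)$, a function $\omega\in L^\infty(\mathbb R;L^\infty_c(\Omega))$ is called a *global weak solution of the Euler equations in $\Omega$ with initial datum $\omega_0$* if there is a measurable velocity field $u\in L^\infty(\mathbb R;L^2(\Omega;\mathbb R^2))$ with $u(t)=\nabla^\perp\Delta_\Omega^{-1}\omega(t)$ for a.e. $t$, where $\nabla^\perp=(-\partial_y,\partial_x)$, and for every $\varphi\in C_c^\infty(\mathbb R\times\Omega)$ $$\int_0^\infty\!\!\int_\Omega\omega\,(\partial_t\varphi+u\cdot\nabla\varphi)\,dx\,dt+\int_\Omega\omega_0\,\varphi(0,\cdot)\,dx=0,\qquad \int_{-\infty}^0\!\int_\Omega\omega\,(\partial_t\varphi+u\cdot\nabla\varphi)\,dx\,dt-\int_\Omega\omega_0\,\varphi(0,\cdot)\,dx=0 .$$ Let $\omega_0\in L^\infty_c(\mathbf D)$ and let $\omega\in L^\infty(\mathbb R;L^\infty_c(\mathbf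 D))$ be a global weak solution of the Euler equations in $\mathbf D$ with initial datum $\omega_0$. Then $\omega_0^\#\in L^\infty_c(\mathbf D^\star)$, and the function $\omega^\star$ given by $\omega^\star(t)=\omega(t)^\#$ for all $t\in\mathbb R$ belongs to $L^\infty(\mathbb R;L^\infty_c(\mathbf D^\star))$ and is a global weak solution of the Euler equations in $\mathbf D^\star$ with initial datum $\omega_0^\#$. In particular, let $T>0$ and let equalities of functions of $x$ and the vanishing below be understood for a.e. $x$. 1. If $\omega(t+T)=\omega(t)$ in $\mathbf D$ for all $t$, then $\omega^\star$ is a $T$-periodic counter-rotating pair: $\mathbf D$ and $\mathtt S(\mathbf D)$ are disjoint subsets of $\mathbf D^\star$, and for all $t$, $\omega^\star(t)$ vanishes outside $\mathbf D\cup\mathtt S(\mathbf D)$, $\omega^\star(t,\mathtt Sx)=-\omega^\star(t,x)$, and $\omega^\star(t+T)=\omega^\star(t)$ in $\mathbf D^\star$. 2. If $\omega$ is a $T$-periodic vortex patch, i.e. $\omega(t)=\Gamma\,\mathbf 1_{A_t}$ with $\Gamma\in\mathbb R$ and measurable sets $A_t=A_{t+T}\subset\mathbf D$ for all $t$, then for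 all $t$, $\omega^\star(t)=\Gamma\,\mathbf 1_{A_t}-\Gamma\,\mathbf 1_{\mathtt S(A_t)}$, where $A_t$ and $\mathtt S(A_t)$ are disjoint measurable subsets of $\mathbf D^\star$ and both are $T$-periodic in $t$. -/

import Mathlib

open MeasureTheory Set Filter Topology
open scoped NNReal

/-! The plane is `ℂ`, with its real inner product and Lebesgue measure. -/

noncomputable section

namespace EulerDuplication

/-- Reflection of the plane through the line joining `z` and `w`. -/
def mirror (z w : ℂ) : ℂ → ℂ :=
  EuclideanGeometry.reflection (affineSpan ℝ ({z, w} : Set ℂ))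

/-- The doubled domain: interior of the union of the closures of `D` and of its mirror image. -/
def doubled (z w : ℂ) (D : Set ℂ) : Set ℂ :=
  interior (closure D ∪ closure (mirror z w '' D))

open Classical in
/-- Odd reflection of a function on `D`: equal to `f` on `D`, to `-f ∘ S` on `S(D)`
(the value on the remaining null set, part of the axis, is `0`). -/
def oddReflection (z w : ℂ) (D : Set ℂ) (f : ℂ → ℝ) : ℂ → ℝ := fun x =>
  if x ∈ D then f x
  else if x ∈ mirror z w '' D then -f (mirror z w x)
  else 0

/-- A function `f` on `D` vanishes almost everywhere outside some compact subset of `D`. -/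
def HasCompactEssSupport (D : Set ℂ) (f : ℂ → ℝ) : Prop :=
  ∃ K : Set ℂ, IsCompact K ∧ K ⊆ D ∧ ∀ᵐ x ∂volume.restrict D, x ∉ K → f x = 0

/-- `f ∈ L^∞_c(D)`: essentially bounded on `D` with compact support in `D`. -/
structure MemLinftyC (D : Set ℂ) (f : ℂ → ℝ) : Prop where
  memLp : MemLp f ⊤ (volume.restrict D)
  compactSupport : HasCompactEssSupport D f

/-- `ω ∈ L^∞(ℝ; L^∞_c(D))`: jointly measurable and essentially bounded on `ℝ × D`,
with compact support in `D` at almost every time. -/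
structure MemLinftyTimeLinftyC (D : Set ℂ) (ω : ℝ → ℂ → ℝ) : Prop where
  memLp : MemLp (fun p : ℝ × ℂ => ω p.1 p.2) ⊤ (volume.restrict (univ ×ˢ D))
  compactSupport : ∀ᵐ t : ℝ, HasCompactEssSupport D (ω t)

/-- Test functions `C_c^∞(D)`. -/
structure IsTest (D : Set ℂ) (φ : ℂ → ℝ) : Prop where
  smooth : ContDiff ℝ ((⊤ : ℕ∞) : WithTop ℕ∞) φ
  compact : HasCompactSupport φ
  supp : tsupport φ ⊆ D

/-- Space-time test functions `C_c^∞(ℝ × D)`. -/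
structure IsSpaceTimeTest (D : Set ℂ) (φ : ℝ × ℂ → ℝ) : Prop where
  smooth : ContDiff ℝ ((⊤ : ℕ∞) : WithTop ℕ∞) φ
  compact : HasCompactSupport φ
  supp : tsupport φ ⊆ univ ×ˢ D

/-- `ψ ∈ H^1_0(D)` with gradient `g = ∂_x ψ + i ∂_y ψ`: the closure of `C_c^∞(D)` for the
`H^1` norm. -/
def IsH10WithGradient (D : Set ℂ) (ψ : ℂ → ℝ) (g : ℂ → ℂ) : Prop :=
  MemLp ψ 2 (volume.restrict D) ∧ MemLp g 2 (volume.restrict D) ∧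
  ∃ φ : ℕ → ℂ → ℝ, (∀ n, IsTest D (φ n)) ∧
    Tendsto (fun n => eLpNorm (fun x => φ n x - ψ x) 2 (volume.restrict D)) atTop (𝓝 0) ∧
    Tendsto (fun n => eLpNorm (fun x => gradient (φ n) x - g x) 2 (volume.restrict D))
      atTop (𝓝 0)

/-- `ψ = Δ_D⁻¹ ω` for the Dirichlet Laplacian, with gradient `g`: `ψ ∈ H^1_0(D)` and
`Δψ = ω` in `D` in the weak sense. -/
def IsDirichletPotential (D : Set ℂ) (ω ψ : ℂ → ℝ) (g : ℂ → ℂ) : Prop :=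
  IsH10WithGradient D ψ g ∧
  ∀ φ : ℂ → ℝ, IsTest D φ →
    ∫ x in D, inner ℝ (g x) (gradient φ x) = -∫ x in D, ω x * φ x

/-- `u = ∇^⊥ Δ_D⁻¹ ω` on `D`, where `∇^⊥ = (-∂_y, ∂_x)` is multiplication by `i` of the
gradient. -/
def IsVelocity (D : Set ℂ) (ω : ℂ → ℝ) (u : ℂ → ℂ) : Prop :=
  ∃ (ψ : ℂ → ℝ) (g : ℂ → ℂ), IsDirichletPotential D ω ψ g ∧
    ∀ᵐ x ∂volume.restrict D, u x = Complex.I * g x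

/-- `ω ∈ L^∞(ℝ; L^∞_c(D))` is a global (in time, on `ℝ`) weak solution of
`∂_t ω + u · ∇ω = 0`, `u = ∇^⊥ Δ_D⁻¹ ω` in `D` with `ω(0) = ω₀`. The velocity is jointly
measurable with bounded energy, and both the forward and the backward Cauchy problem hold against
test functions; `fderiv ℝ φ (t, x) (1, u t x)` is `(∂_t φ + u · ∇φ)(t, x)`. -/
structure IsGlobalWeakSolution (D : Set ℂ) (ω₀ : ℂ → ℝ) (ω : ℝ → ℂ → ℝ) : Prop where
  mem : MemLinftyTimeLinftyC D ω
  weak : ∃ u : ℝ → ℂ → ℂ,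
    AEStronglyMeasurable (fun p : ℝ × ℂ => u p.1 p.2) (volume.restrict (univ ×ˢ D)) ∧
    (∃ C : ℝ≥0, ∀ᵐ t : ℝ, eLpNorm (u t) 2 (volume.restrict D) ≤ C) ∧
    (∀ᵐ t : ℝ, IsVelocity D (ω t) (u t)) ∧
    ∀ φ : ℝ × ℂ → ℝ, IsSpaceTimeTest D φ →
      (∫ t in Ioi (0 : ℝ), ∫ x in D, ω t x * fderiv ℝ φ (t, x) (1, u t x))
          + ∫ x in D, ω₀ x * φ (0, x) = 0 ∧
      (∫ t in Iio (0 : ℝ), ∫ x in D, ω t x * fderiv ℝ φ (t, x) (1, u t x))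
          - ∫ x in D, ω₀ x * φ (0, x) = 0

/-- `ω` is periodic in time with period `T > 0`, as a function on `D` defined up to null sets. -/
def IsTimePeriodic (D : Set ℂ) (T : ℝ) (ω : ℝ → ℂ → ℝ) : Prop :=
  0 < T ∧ ∀ t : ℝ, ω (t + T) =ᵐ[volume.restrict D] ω t

/-- `ω`, on the doubled domain, is a `T`-periodic counter-rotating pair: it is made of two disjoint
pieces, one carried by `D` and one carried by `S(D)`, mirror images of each other with opposite
sign, and it is periodic in time with period `T`. -/
structure IsPeriodicCounterRotatingPair (z w : ℂ) (D : Set ℂ) (T : ℝ) (ω : ℝ → ℂ → ℝ) :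
    Prop where
  disjoint : Disjoint D (mirror z w '' D)
  subset : D ∪ mirror z w '' D ⊆ doubled z w D
  carried : ∀ t : ℝ, ∀ᵐ x ∂volume.restrict (doubled z w D),
    x ∉ D ∪ mirror z w '' D → ω t x = 0
  odd : ∀ t : ℝ, ∀ᵐ x ∂volume.restrict (doubled z w D), ω t (mirror z w x) = -ω t x
  periodic : IsTimePeriodic (doubled z w D) T ω

/-- `ω(t) = Γ 1_{A(t)}` is a `T`-periodic vortex patch in `D`. -/
structure IsPeriodicPatch (D : Set ℂ) (T Γ : ℝ) (A : ℝ → Set ℂ) (ω : ℝ → ℂ → ℝ) : Prop where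
  pos : 0 < T
  measurable : ∀ t, MeasurableSet (A t)
  subset : ∀ t, A t ⊆ D
  periodic : ∀ t, A (t + T) = A t
  eq : ∀ t, ω t =ᵐ[volume.restrict D] (A t).indicator fun _ => Γ

/-- `ω(t) = Γ 1_{A(t)} - Γ 1_{B(t)}` is a `T`-periodic pair of patches in `D` with disjoint supports
and opposite strengths. -/
structure IsPeriodicPatchPair (D : Set ℂ) (T Γ : ℝ) (A B : ℝ → Set ℂ) (ω : ℝ → ℂ → ℝ) :
    Prop where
  pos : 0 < T
  measurable : ∀ t, MeasurableSet (A t) ∧ MeasurableSet (B t)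
  subset : ∀ t, A t ⊆ D ∧ B t ⊆ D
  disjoint : ∀ t, Disjoint (A t) (B t)
  periodic : ∀ t, A (t + T) = A t ∧ B (t + T) = B t
  eq : ∀ t, ω t =ᵐ[volume.restrict D]
    fun x => (A t).indicator (fun _ => Γ) x - (B t).indicator (fun _ => Γ) x

end EulerDuplication

end

noncomputable section

namespace EulerDuplication

/-! The domain lies strictly on one side `{0 < y}` of the axis. An axis point of `D` would have a
boundary point of `D` on the axis on either side of it; both would lie in the segment, hence so
would the point itself, which is impossible since `D` is open. As `D` has no slits, the doubled
domain meets `{0 < y}` in `D` alone, so it is `D ∪ S(D)` up to a null set, and its measure is `μ +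
S_* μ` with `μ` the measure on `D` (`exists_isOneSided`).

Folding an integral over the doubled domain back onto `D` replaces a test function `φ` by `η = φ - φ
∘ S`. The signs match: the gradient of an odd reflection is reflected with a minus sign, and
multiplication by `i` anticommutes with the reflection, so the velocity is reflected with a plus
sign. The weak equations on the doubled domain thus become those on `D` tested against `η`.

However, `η` need not have compact support in `D`; it only vanishes on the axis. Being Lipschitz and
odd, it satisfies `|η| ≤ C |y|`. Multiplying by a cutoff at height `1/n` costs a derivative of size
`n`, but only where `|η|` is of order `1/n`. Hence `η` is a pointwise limit on `D`, bounded in `C¹`,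
of admissible test functions (`exists_cutoff`). Dominated convergence then extends the weak
equations to `η`; this only needs integrability of the gradient and of the transport term, so no
trace or boundary regularity enters. -/

/-! ### The mirror map -/

/-- The linear part of the mirror map. -/
def mirrorLin (z w : ℂ) : ℂ ≃ₗᵢ[ℝ] ℂ :=
  (EuclideanGeometry.reflection (affineSpan ℝ ({z, w} : Set ℂ))).linearIsometryEquiv

lemma mirror_mirror (z w x : ℂ) : mirror z w (mirror z w x) = x :=
  EuclideanGeometry.reflection_reflection _ _

lemma mirror_sub (z w x y : ℂ) : mirror z w x - mirror z w y = mirrorLin z w (x - y) :=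
  ((EuclideanGeometry.reflection (affineSpan ℝ ({z, w} : Set ℂ))).map_vsub x y).symm

lemma mirror_left (z w : ℂ) : mirror z w z = z :=
  (EuclideanGeometry.reflection_eq_self_iff z).2 (left_mem_affineSpan_pair ℝ z w)

lemma mirror_eq_add (z w x : ℂ) : mirror z w x = mirrorLin z w (x - z) + z := by
  rw [← mirror_sub, mirror_left]; ring

lemma mirrorLin_mirrorLin (z w v : ℂ) : mirrorLin z w (mirrorLin z w v) = v := by
  have h := mirror_sub z w (mirror z w (v + z)) (mirror z w z)
  rw [mirror_mirror, mirror_mirror, mirror_sub] at h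
  simpa using h.symm

/-- In the coordinate `v / (w - z)` the axis direction is the real line, so the reflection is
complex conjugation. It suffices to compare both sides on `w - z` and `i (w - z)`. -/
lemma mirrorLin_apply {z w : ℂ} (hzw : z ≠ w) (v : ℂ) :
    mirrorLin z w v = (w - z) * (starRingEnd ℂ) (v / (w - z)) := by
  have hd : w - z ≠ 0 := sub_ne_zero.2 hzw.symm
  have h1 : mirrorLin z w (w - z) = w - z := by
    rw [← mirror_sub, mirror_left]
    congr 1
    exact (EuclideanGeometry.reflection_eq_self_iff w).2 (right_mem_affineSpan_pair ℝ z w)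
  have h2 : mirrorLin z w (Complex.I * (w - z)) = -(Complex.I * (w - z)) := by
    have horth : Complex.I * (w - z) ∈ (affineSpan ℝ ({z, w} : Set ℂ)).directionᗮ := by
      rw [direction_affineSpan, Submodule.mem_orthogonal]
      intro u hu
      obtain ⟨r, rfl⟩ := (mem_vectorSpan_pair_rev (k := ℝ)).1 hu
      rw [vsub_eq_sub, real_inner_smul_left, Complex.inner]
      simp
      right; ring
    have h := EuclideanGeometry.reflection_orthogonal_vadd (left_mem_affineSpan_pair ℝ z w) horth
    have h' := mirror_eq_add z w (Complex.I * (w - z) + z)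
    rw [add_sub_cancel_right] at h'
    exact add_right_cancel (h'.symm.trans h)
  have h3 : v = (v / (w - z)).re • (w - z) + (v / (w - z)).im • (Complex.I * (w - z)) := by
    simp only [Complex.real_smul]
    have := Complex.re_add_im (v / (w - z))
    calc v = (v / (w - z)) * (w - z) := by field_simp
      _ = ((v / (w - z)).re + (v / (w - z)).im * Complex.I) * (w - z) := by rw [this]
      _ = _ := by ring
  conv_lhs => rw [h3]
  rw [map_add, map_smul, map_smul, h1, h2]
  have := Complex.re_add_im ((starRingEnd ℂ) (v / (w - z)))
  rw [← this, Complex.conj_re, Complex.conj_im]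
  simp only [Complex.real_smul]
  push_cast
  ring

/-- The reflection reverses orientation, hence is conjugate-linear. This is the source of the
opposite signs with which gradients and velocities are reflected. -/
lemma mirrorLin_I_mul {z w : ℂ} (hzw : z ≠ w) (v : ℂ) :
    mirrorLin z w (Complex.I * v) = -(Complex.I * mirrorLin z w v) := by
  rw [mirrorLin_apply hzw, mirrorLin_apply hzw, mul_div_assoc, map_mul, Complex.conj_I]; ring

lemma inner_mirrorLin (z w a b : ℂ) :
    inner ℝ (mirrorLin z w a) b = inner ℝ a (mirrorLin z w b) := by
  rw [← (mirrorLin z w).inner_map_map a, mirrorLin_mirrorLin]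

lemma hasFDerivAt_mirror (z w x : ℂ) :
    HasFDerivAt (mirror z w) ((mirrorLin z w : ℂ ≃L[ℝ] ℂ) : ℂ →L[ℝ] ℂ) x := by
  have h := (((mirrorLin z w : ℂ ≃L[ℝ] ℂ) : ℂ →L[ℝ] ℂ).hasFDerivAt (x := x - z)).comp x
    ((hasFDerivAt_id x).sub_const z)
  refine (h.add_const z).congr_of_eventuallyEq (.of_forall fun y => ?_) |>.congr_fderiv ?_
  · simp [mirror_eq_add]
  · ext1 v; simp

lemma contDiff_mirror {n : WithTop ℕ∞} (z w : ℂ) : ContDiff ℝ n (mirror z w) := by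
  have : mirror z w = fun x => mirrorLin z w (x - z) + z := funext (mirror_eq_add z w)
  rw [this]
  exact ((mirrorLin z w).contDiff.comp (contDiff_id.sub contDiff_const)).add contDiff_const

/-- The mirror map as a homeomorphism. -/
def mirrorHomeo (z w : ℂ) : ℂ ≃ₜ ℂ where
  toFun := mirror z w
  invFun := mirror z w
  left_inv := mirror_mirror z w
  right_inv := mirror_mirror z w
  continuous_toFun := (contDiff_mirror (n := 0) z w).continuous
  continuous_invFun := (contDiff_mirror (n := 0) z w).continuous

lemma continuous_mirror (z w : ℂ) : Continuous (mirror z w) := (mirrorHomeo z w).continuous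

lemma measurableEmbedding_mirror (z w : ℂ) : MeasurableEmbedding (mirror z w) :=
  (mirrorHomeo z w).measurableEmbedding

lemma measurePreserving_mirror (z w : ℂ) : MeasurePreserving (mirror z w) volume volume := by
  have h := ((mirrorLin z w).measurePreserving.comp
    (measurePreserving_sub_right (volume : Measure ℂ) z))
  have h' := (measurePreserving_add_right (volume : Measure ℂ) z).comp h
  convert h' using 1
  exact funext (mirror_eq_add z w)

lemma mem_mirror_image {z w x : ℂ} {D : Set ℂ} : x ∈ mirror z w '' D ↔ mirror z w x ∈ D := by
  constructor
  · rintro ⟨y, hy, rfl⟩; rwa [mirror_mirror]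
  · exact fun h => ⟨_, h, mirror_mirror z w x⟩

/-! ### The axis and the side of the axis on which the domain lies -/

/-- Signed coordinate transversal to the axis through `z` and `w`. -/
def axisCoord (z w : ℂ) (σ : ℝ) (x : ℂ) : ℝ := σ * ((x - z) / (w - z)).im

lemma axisCoord_mirror {z w : ℂ} (hzw : z ≠ w) (σ : ℝ) (x : ℂ) :
    axisCoord z w σ (mirror z w x) = -axisCoord z w σ x := by
  have hd : w - z ≠ 0 := sub_ne_zero.2 hzw.symm
  rw [axisCoord, axisCoord, mirror_eq_add, mirrorLin_apply hzw, add_sub_cancel_right,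
    mul_div_cancel_left₀ _ hd, Complex.conj_im]
  ring

lemma exists_axisCoord_eq_clm (z w : ℂ) (σ : ℝ) : ∃ ℓ : ℂ →L[ℝ] ℝ, ∀ x,
    axisCoord z w σ x = ℓ (x - z) := by
  refine ⟨σ • (Complex.imCLM.comp
    ((ContinuousLinearMap.mul ℝ ℂ ((w - z)⁻¹)))), fun x => ?_⟩
  simp only [axisCoord, div_eq_inv_mul]
  simp

/-- A point and its image are at twice the distance to the axis, and the coordinate measures that
distance in units of `‖w - z‖`. Combined with a Lipschitz bound, this makes `φ - φ ∘ S` vanish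
linearly at the axis. -/
lemma norm_sub_mirror_le {z w : ℂ} (hzw : z ≠ w) {σ : ℝ} (hσ : |σ| = 1) (x : ℂ) :
    ‖x - mirror z w x‖ ≤ (2 * ‖w - z‖) * |axisCoord z w σ x| := by
  have hd : w - z ≠ 0 := sub_ne_zero.2 hzw.symm
  have : x - mirror z w x
      = (w - z) * ((x - z) / (w - z) - (starRingEnd ℂ) ((x - z) / (w - z))) := by
    rw [mirror_eq_add, mirrorLin_apply hzw, mul_sub, mul_div_cancel₀ _ hd]; ring
  rw [this, Complex.sub_conj, axisCoord, norm_mul, abs_mul, hσ, norm_mul, Complex.norm_I,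
    Complex.norm_real, Real.norm_eq_abs, abs_mul]
  simp
  apply le_of_eq; ring

lemma axisCoord_eq_zero_iff {z w : ℂ} (hzw : z ≠ w) {σ : ℝ} (hσ : |σ| = 1) (x : ℂ) :
    axisCoord z w σ x = 0 ↔ x ∈ (affineSpan ℝ ({z, w} : Set ℂ) : Set ℂ) := by
  have h : x ∈ (affineSpan ℝ ({z, w} : Set ℂ) : Set ℂ) ↔ mirror z w x = x :=
    (EuclideanGeometry.reflection_eq_self_iff x).symm
  rw [h]
  constructor
  · intro h0
    have := norm_sub_mirror_le hzw hσ x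
    rw [h0, abs_zero, mul_zero] at this
    exact (sub_eq_zero.1 (norm_le_zero_iff.1 this)).symm
  · intro hx
    have := axisCoord_mirror hzw σ x
    rw [hx] at this
    linarith

/-- Otherwise the interior and the exterior of `t` would separate `s`. -/
lemma inter_frontier_nonempty_of_isPreconnected {X : Type*} [TopologicalSpace X] {s t : Set X}
    (hs : IsPreconnected s) (h : (s ∩ t).Nonempty) (h' : (s ∩ tᶜ).Nonempty) :
    (s ∩ frontier t).Nonempty := by
  by_contra hne
  rw [Set.not_nonempty_iff_eq_empty, ← Set.disjoint_iff_inter_eq_empty, Set.disjoint_left] at hne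
  obtain ⟨a, has, hat⟩ := h
  obtain ⟨b, hbs, hbt⟩ := h'
  obtain ⟨c, -, hc, hc'⟩ := hs (interior t) (closure t)ᶜ isOpen_interior isClosed_closure.isOpen_compl
    (fun x hx => by
      by_contra hx'
      rw [mem_union, not_or, mem_compl_iff, not_not] at hx'
      exact hne hx ⟨hx'.2, hx'.1⟩)
    ⟨a, has, by_contra fun ha => hne has ⟨subset_closure hat, ha⟩⟩
    ⟨b, hbs, fun hb => hne hbs ⟨hb, fun hb' => hbt (interior_subset hb')⟩⟩
  exact hc' (interior_subset_closure hc)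

/-- A bounded open set whose boundary meets the axis exactly in the segment `[z, w]` does not meet
the axis. -/
lemma disjoint_axis {D : Set ℂ} (hD : IsOpen D) (hb : Bornology.IsBounded D) {z w : ℂ}
    (hzw : z ≠ w)
    (hseg : frontier D ∩ (affineSpan ℝ ({z, w} : Set ℂ) : Set ℂ) = segment ℝ z w) :
    Disjoint D (affineSpan ℝ ({z, w} : Set ℂ) : Set ℂ) := by
  rw [Set.disjoint_left]
  intro p hp hpl
  have hd : 0 < dist z w := dist_pos.2 hzw
  set γ : ℝ → ℂ := fun t => AffineMap.lineMap z w t with hγ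
  have hγc : Continuous γ := AffineMap.lineMap_continuous
  have hγinj : Function.Injective γ := AffineMap.lineMap_injective ℝ hzw
  obtain ⟨a, rfl⟩ : ∃ a : ℝ, γ a = p := _root_.mem_affineSpan_pair_iff_exists_lineMap_eq.1 hpl
  obtain ⟨R, hR⟩ := hb.subset_closedBall z
  have hout : ∀ t : ℝ, R < |t| * dist z w → γ t ∉ D := by
    intro t ht htD
    have := hR htD
    rw [Metric.mem_closedBall, hγ, dist_lineMap_left, Real.norm_eq_abs] at this
    linarith
  -- Any interval of parameters joining `a` to a point outside `D` contains a boundary crossing,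
  -- which `hseg` places at a parameter in `[0, 1]`. Applied to both half-lines issuing from `a`,
  -- this traps `a` itself in `[0, 1]`.
  have hfr : ∀ s : Set ℝ, IsPreconnected s → a ∈ s → (∃ t ∈ s, R < |t| * dist z w) →
      ∃ t ∈ s, t ∈ Icc (0 : ℝ) 1 := by
    rintro s hs has ⟨t, hts, ht⟩
    obtain ⟨q, ⟨r, hrs, rfl⟩, hq⟩ := inter_frontier_nonempty_of_isPreconnected
      (hs.image γ hγc.continuousOn)
      ⟨γ a, mem_image_of_mem γ has, hp⟩ ⟨γ t, mem_image_of_mem γ hts, hout t ht⟩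
    have : γ r ∈ segment ℝ z w := hseg ▸ ⟨hq, AffineMap.lineMap_mem_affineSpan_pair r z w⟩
    rw [segment_eq_image_lineMap] at this
    obtain ⟨r', hr', he⟩ := this
    exact ⟨r, hrs, hγinj he ▸ hr'⟩
  have hlarge : ∃ b : ℝ, |a| ≤ b ∧ R < b * dist z w := by
    obtain ⟨n, hn⟩ := exists_gt (R / dist z w)
    refine ⟨max |a| n, le_max_left _ _, ?_⟩
    rw [div_lt_iff₀ hd] at hn
    exact hn.trans_le (by gcongr; exact le_max_right _ _)
  obtain ⟨b, hab, hb⟩ := hlarge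
  have hb0 : 0 ≤ b := (abs_nonneg a).trans hab
  obtain ⟨t, ht, ht'⟩ := hfr (Ici a) isPreconnected_Ici self_mem_Ici
    ⟨b, (le_abs_self a).trans hab, by rwa [abs_of_nonneg hb0]⟩
  obtain ⟨s, hs, hs'⟩ := hfr (Iic a) isPreconnected_Iic self_mem_Iic
    ⟨-b, by have := neg_abs_le a; simp only [mem_Iic]; linarith,
      by rwa [abs_neg, abs_of_nonneg hb0]⟩
  have hmem : γ a ∈ segment ℝ z w := by
    rw [segment_eq_image_lineMap]
    exact ⟨a, ⟨hs'.1.trans hs, ht.trans ht'.2⟩, rfl⟩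
  rw [← hseg] at hmem
  have := hmem.1
  rw [frontier, hD.interior_eq] at this
  exact this.2 hp

/-- The properties of a domain lying on one side `{y > 0}` of the axis through `z` and `w`, and of
its double, on which the duplication principle relies. -/
structure IsOneSided (z w : ℂ) (D : Set ℂ) (y : ℂ → ℝ) : Prop where
  ne : z ≠ w
  isOpen : IsOpen D
  volume_ne_top : volume D ≠ ⊤
  affine : ∃ ℓ : ℂ →L[ℝ] ℝ, ∀ x, y x = ℓ (x - z)
  y_mirror : ∀ x, y (mirror z w x) = -y x
  norm_sub_le : ∃ C : ℝ, 0 ≤ C ∧ ∀ x, ‖x - mirror z w x‖ ≤ C * |y x|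
  pos : ∀ x ∈ D, 0 < y x
  mem_of_pos : ∀ x ∈ doubled z w D, 0 < y x → x ∈ D
  mirror_mem : ∀ x ∈ doubled z w D, mirror z w x ∈ doubled z w D
  subset : D ∪ mirror z w '' D ⊆ doubled z w D
  restrict : volume.restrict (doubled z w D)
    = volume.restrict D + (volume.restrict D).map (mirror z w)

/-- `D` is connected and avoids the axis, so it lies in one open half-plane; the sign `σ` makes that
half-plane the positive one. -/
lemma exists_isOneSided {D : Set ℂ} (hD_open : IsOpen D) (hD_bdd : Bornology.IsBounded D)
    (hD_sc : IsSimplyConnected D) (hD_reg : interior (closure D) = D) {z w : ℂ} (hzw : z ≠ w)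
    (hseg : frontier D ∩ (affineSpan ℝ ({z, w} : Set ℂ) : Set ℂ) = segment ℝ z w) :
    ∃ y, IsOneSided z w D y := by
  obtain ⟨σ, hσ, hpos⟩ : ∃ σ : ℝ, |σ| = 1 ∧ ∀ x ∈ D, 0 < axisCoord z w σ x := by
    have hdis := disjoint_axis hD_open hD_bdd hzw hseg
    have hne : ∀ x ∈ D, axisCoord z w 1 x ≠ 0 := fun x hx h0 =>
      Set.disjoint_left.1 hdis hx ((axisCoord_eq_zero_iff hzw (by simp) x).1 h0)
    have hcont : Continuous (axisCoord z w 1) := by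
      unfold axisCoord; fun_prop
    have hconn : IsPreconnected D := hD_sc.isPathConnected.isConnected.isPreconnected
    rcases hconn.subset_or_subset (isOpen_lt continuous_const hcont : IsOpen {x | 0 < axisCoord z w 1 x})
      (isOpen_lt hcont continuous_const : IsOpen {x | axisCoord z w 1 x < 0})
      (Set.disjoint_left.2 fun x hx hx' => lt_asymm (show 0 < axisCoord z w 1 x from hx) hx')
      (fun x hx => (hne x hx).lt_or_gt.symm) with h | h
    · exact ⟨1, by simp, fun x hx => h hx⟩
    · refine ⟨-1, by simp, fun x hx => ?_⟩
      have : axisCoord z w 1 x < 0 := h hx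
      simp only [axisCoord] at this ⊢
      linarith
  have hyc : Continuous (axisCoord z w σ) := by unfold axisCoord; fun_prop
  have hclD : ∀ x ∈ closure D, 0 ≤ axisCoord z w σ x := fun x hx =>
    closure_minimal (fun x hx => (hpos x hx).le) (isClosed_le continuous_const hyc) hx
  have hclS : ∀ x ∈ closure (mirror z w '' D), axisCoord z w σ x ≤ 0 := fun x hx =>
    closure_minimal (t := {x | axisCoord z w σ x ≤ 0}) (by
      rintro _ ⟨x, hx, rfl⟩
      simp only [mem_ofPred_eq, axisCoord_mirror hzw]
      linarith [hpos x hx]) (isClosed_le hyc continuous_const) hx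
  have himage : mirror z w '' closure D = closure (mirror z w '' D) :=
    (mirrorHomeo z w).image_closure D
  -- The closure of `S(D)` stays in `{y ≤ 0}`, so near a point with `0 < y` the doubled domain is
  -- covered by `closure D` alone. Equality of `D` with the interior of its closure concludes.
  have hmem_pos : ∀ x ∈ doubled z w D, 0 < axisCoord z w σ x → x ∈ D := by
    intro x hx hy
    rw [← hD_reg]
    rw [doubled, mem_interior_iff_mem_nhds] at hx
    rw [mem_interior_iff_mem_nhds]
    filter_upwards [hx, (isOpen_lt continuous_const hyc).mem_nhds hy] with p hp hp'
    exact hp.resolve_right fun h => (hclS p h).not_gt hp'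
  have hsymm : ∀ x ∈ doubled z w D, mirror z w x ∈ doubled z w D := by
    intro x hx
    have : mirror z w '' (closure D ∪ closure (mirror z w '' D))
        = closure D ∪ closure (mirror z w '' D) := by
      rw [image_union, himage, ← himage, image_image]
      simp only [mirror_mirror, image_id', union_comm]
    have h2 : mirror z w '' doubled z w D = doubled z w D := by
      have := (mirrorHomeo z w).image_interior (closure D ∪ closure (mirror z w '' D))
      rw [show ⇑(mirrorHomeo z w) = mirror z w from rfl] at this
      rw [doubled, this]
      congr 1
    rw [← h2]; exact mem_image_of_mem _ hx
  have hSopen : IsOpen (mirror z w '' D) := (mirrorHomeo z w).isOpenMap _ hD_open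
  have hsub : D ∪ mirror z w '' D ⊆ doubled z w D :=
    interior_maximal (union_subset_union subset_closure subset_closure) (hD_open.union hSopen)
  have hnull : volume (affineSpan ℝ ({z, w} : Set ℂ) : Set ℂ) = 0 := by
    refine Measure.addHaar_affineSubspace volume _ fun htop => ?_
    obtain ⟨x, hx⟩ := hD_sc.nonempty
    refine (hpos x hx).ne' ((axisCoord_eq_zero_iff hzw hσ x).2 ?_)
    rw [htop]; trivial
  -- A point of the doubled domain with `y ≠ 0` is in `D` or in `S(D)`, by the previous facts; only
  -- points of the axis remain.
  have hae : doubled z w D =ᵐ[volume] (D ∪ mirror z w '' D : Set ℂ) := by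
    refine ae_eq_set.2 ⟨measure_mono_null ?_ hnull, by rw [sdiff_eq_empty.2 hsub, measure_empty]⟩
    rintro x ⟨hx, hx'⟩
    rw [← axisCoord_eq_zero_iff hzw hσ]
    by_contra h0
    rcases lt_or_gt_of_ne h0 with h | h
    · refine hx' (Or.inr (mem_mirror_image.2 (hmem_pos _ (hsymm x hx) ?_)))
      rw [axisCoord_mirror hzw]; linarith
    · exact hx' (Or.inl (hmem_pos x hx h))
  have hdisj : Disjoint D (mirror z w '' D) := Set.disjoint_left.2 fun x hx hx' =>
    (hpos x hx).not_ge (hclS x (subset_closure hx'))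
  refine ⟨axisCoord z w σ, hzw, hD_open, hD_bdd.measure_lt_top.ne, exists_axisCoord_eq_clm z w σ,
    axisCoord_mirror hzw σ, ⟨_, by positivity, norm_sub_mirror_le hzw hσ⟩, hpos, hmem_pos,
    hsymm, hsub, ?_⟩
  rw [Measure.restrict_congr_set hae, Measure.restrict_union hdisj hSopen.measurableSet]
  congr 1
  exact ((measurePreserving_mirror z w).restrict_image_emb (measurableEmbedding_mirror z w) D
    ).map_eq.symm

/-! ### Cutting off a function that vanishes on a hypersurface -/

lemma deriv_smoothTransition_of_notMem {t : ℝ} (h : t ∉ Icc (0 : ℝ) 1) :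
    deriv Real.smoothTransition t = 0 := by
  rw [mem_Icc, not_and_or, not_le, not_le] at h
  rcases h with h | h
  · have : Real.smoothTransition =ᶠ[𝓝 t] fun _ => 0 := by
      filter_upwards [Iio_mem_nhds h] with s hs
      exact Real.smoothTransition.zero_of_nonpos (le_of_lt hs)
    rw [this.deriv_eq, deriv_const]
  · have : Real.smoothTransition =ᶠ[𝓝 t] fun _ => 1 := by
      filter_upwards [Ioi_mem_nhds h] with s hs
      exact Real.smoothTransition.one_of_one_le (le_of_lt hs)
    rw [this.deriv_eq, deriv_const]

lemma exists_bound_deriv_smoothTransition :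
    ∃ B : ℝ, 0 ≤ B ∧ ∀ t, |deriv Real.smoothTransition t| ≤ B := by
  have hc : Continuous (deriv Real.smoothTransition) :=
    (Real.smoothTransition.contDiff (n := 1)).continuous_deriv le_rfl
  obtain ⟨B, hB⟩ := (isCompact_Icc (a := (0 : ℝ)) (b := 1)).exists_bound_of_continuousOn
    hc.continuousOn
  refine ⟨B, (norm_nonneg _).trans (hB 0 (by simp)), fun t => ?_⟩
  by_cases h : t ∈ Icc (0 : ℝ) 1
  · exact hB t h
  · rw [deriv_smoothTransition_of_notMem h, abs_zero]
    exact (norm_nonneg _).trans (hB 0 (by simp))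

/-- A compactly supported smooth function bounded by a multiple of `|y|` is, on `{0 < y}`, a
pointwise limit in `C¹` of smooth functions supported in `{0 < y}` and bounded in `C¹`. -/
lemma exists_cutoff {E : Type*} [NormedAddCommGroup E] [NormedSpace ℝ E] {η y : E → ℝ} {C B : ℝ}
    (hη : ContDiff ℝ ((⊤ : ℕ∞) : WithTop ℕ∞) η) (hηc : HasCompactSupport η)
    (hC : ∀ x, |η x| ≤ C * |y x|)
    (hy : ContDiff ℝ ((⊤ : ℕ∞) : WithTop ℕ∞) y) (hB : ∀ x, ‖fderiv ℝ y x‖ ≤ B) :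
    ∃ (θ : ℕ → E → ℝ) (M : ℝ), (∀ n, ContDiff ℝ ((⊤ : ℕ∞) : WithTop ℕ∞) (θ n)) ∧
      (∀ n, tsupport (θ n) ⊆ tsupport η ∩ {x | 0 < y x}) ∧
      (∀ n x, |θ n x| ≤ M) ∧ (∀ n x, ‖fderiv ℝ (θ n) x‖ ≤ M) ∧
      ∀ x, 0 < y x → Tendsto (fun n => θ n x) atTop (𝓝 (η x)) ∧
        Tendsto (fun n => fderiv ℝ (θ n) x) atTop (𝓝 (fderiv ℝ η x)) := by
  obtain ⟨A, hA0, hA⟩ := exists_bound_deriv_smoothTransition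
  obtain ⟨M₀, hM₀⟩ := hηc.exists_bound_of_continuous hη.continuous
  obtain ⟨M₁, hM₁⟩ := (hηc.fderiv (𝕜 := ℝ)).exists_bound_of_continuous
    (hη.continuous_fderiv (by simp))
  -- The cutoff rises from `0` at `y = 1/(n+1)` to `1` at `y = 2/(n+1)`. The shift by `1` keeps its
  -- support away from `{y = 0}`.
  set χ : ℕ → E → ℝ := fun n x => Real.smoothTransition ((n + 1) * y x - 1) with hχ
  have hχs : ∀ n, ContDiff ℝ ((⊤ : ℕ∞) : WithTop ℕ∞) (χ n) := fun n =>
    Real.smoothTransition.contDiff.comp ((contDiff_const.mul hy).sub contDiff_const)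
  have hχ0 : ∀ n x, 0 ≤ χ n x := fun n x => Real.smoothTransition.nonneg _
  have hχ1 : ∀ n x, χ n x ≤ 1 := fun n x => Real.smoothTransition.le_one _
  have hM₀0 : 0 ≤ M₀ := (norm_nonneg _).trans (hM₀ 0)
  have hM₁0 : 0 ≤ M₁ := (norm_nonneg _).trans (hM₁ 0)
  have hB0 : 0 ≤ B := (norm_nonneg _).trans (hB 0)
  have hdχ : ∀ n x, HasFDerivAt (χ n) (deriv Real.smoothTransition ((n + 1) * y x - 1) •
      (((n : ℝ) + 1) • fderiv ℝ y x)) x := by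
    intro n x
    have h1 : HasFDerivAt (fun x => ((n : ℝ) + 1) * y x - 1) (((n : ℝ) + 1) • fderiv ℝ y x) x :=
      (((hy.differentiable (by simp)) x).hasFDerivAt.const_mul _).sub_const 1
    have h2 := ((Real.smoothTransition.contDiff (n := 1)).differentiable (by simp)
      (((n : ℝ) + 1) * y x - 1)).hasDerivAt
    exact h2.comp_hasFDerivAt x h1
  -- The derivative of `χ n` is at most `A (n+1) B` and vanishes unless `|y| ≤ 2/(n+1)`, where `|η|
  -- ≤ 2|C|/(n+1)`; the factors `n+1` cancel.
  have hηχ : ∀ n x, ‖η x • fderiv ℝ (χ n) x‖ ≤ |C| * 2 * A * B := by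
    intro n x
    rw [(hdχ n x).fderiv, norm_smul, norm_smul, norm_smul, Real.norm_eq_abs, Real.norm_eq_abs,
      Real.norm_eq_abs, abs_of_nonneg (by positivity : (0 : ℝ) ≤ (n : ℝ) + 1)]
    by_cases h : ((n : ℝ) + 1) * y x - 1 ∈ Icc (0 : ℝ) 1
    · have hypos : 0 ≤ y x := by
        have : 0 ≤ ((n : ℝ) + 1) * y x := by linarith [h.1]
        exact nonneg_of_mul_nonneg_right this (by positivity)
      have h2 : ((n : ℝ) + 1) * |y x| ≤ 2 := by rw [abs_of_nonneg hypos]; linarith [h.2]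
      calc |η x| * (|deriv Real.smoothTransition (((n : ℝ) + 1) * y x - 1)|
            * (((n : ℝ) + 1) * ‖fderiv ℝ y x‖))
          ≤ (|C| * |y x|) * (A * (((n : ℝ) + 1) * B)) := by
            gcongr
            · exact (hC x).trans (by gcongr; exact le_abs_self C)
            · exact hA _
            · exact hB x
        _ = |C| * (((n : ℝ) + 1) * |y x|) * A * B := by ring
        _ ≤ _ := by gcongr
    · rw [deriv_smoothTransition_of_notMem h]
      simp only [abs_zero, zero_mul, mul_zero]
      positivity
  refine ⟨fun n x => η x * χ n x, M₀ + M₁ + |C| * 2 * A * B, fun n => hη.mul (hχs n), fun n => ?_,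
    fun n x => ?_, fun n x => ?_, fun x hx => ?_⟩
  · refine subset_inter (closure_mono (Function.support_mul_subset_left _ _)) ?_
    have hcl : IsClosed {x | 1 ≤ ((n : ℝ) + 1) * y x} :=
      isClosed_le continuous_const (continuous_const.mul hy.continuous)
    refine Subset.trans (closure_minimal (fun x hx => ?_) hcl) fun x (hx : 1 ≤ ((n : ℝ) + 1) * y x) => ?_
    · by_contra h
      refine (right_ne_zero_of_mul hx) (Real.smoothTransition.zero_of_nonpos ?_)
      simp only [mem_ofPred_eq, not_le] at h
      linarith
    · exact pos_of_mul_pos_right (zero_lt_one.trans_le hx) (by positivity)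
  · rw [abs_mul, abs_of_nonneg (hχ0 n x)]
    calc |η x| * χ n x ≤ M₀ * 1 := by gcongr; exacts [hχ0 n x, hM₀ x, hχ1 n x]
      _ ≤ _ := by
        have : 0 ≤ |C| * 2 * A * B := by positivity
        linarith
  · have : fderiv ℝ (fun x => η x * χ n x) x = η x • fderiv ℝ (χ n) x + χ n x • fderiv ℝ η x :=
      fderiv_fun_mul ((hη.differentiable (by simp)) x) (((hχs n).differentiable (by simp)) x)
    rw [this]
    calc _ ≤ ‖η x • fderiv ℝ (χ n) x‖ + ‖χ n x • fderiv ℝ η x‖ := norm_add_le _ _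
      _ ≤ |C| * 2 * A * B + 1 * M₁ := by
        gcongr
        · exact hηχ n x
        · rw [norm_smul, Real.norm_eq_abs, abs_of_nonneg (hχ0 n x)]
          gcongr; exacts [hχ1 n x, hM₁ x]
      _ ≤ _ := by linarith
  -- Once `(n+1) y x > 2` the cutoff is `1` on a whole neighbourhood of `x`, so values and
  -- derivatives both stabilise.
  · obtain ⟨N, hN⟩ := exists_nat_gt (2 / y x)
    have hev : ∀ᶠ n : ℕ in atTop, (fun x => η x * χ n x) =ᶠ[𝓝 x] η := by
      filter_upwards [eventually_ge_atTop N] with n hn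
      have hlt : 2 < ((n : ℝ) + 1) * y x := by
        rw [div_lt_iff₀ hx] at hN
        refine hN.trans_le ?_
        gcongr
        have : (N : ℝ) ≤ n := by exact_mod_cast hn
        linarith
      filter_upwards [(isOpen_lt continuous_const
        (continuous_const.mul hy.continuous)).mem_nhds hlt] with p (hp : 2 < ((n : ℝ) + 1) * y p)
      rw [hχ]
      simp only
      rw [Real.smoothTransition.one_of_one_le (by linarith), mul_one]
    exact ⟨tendsto_const_nhds.congr' (hev.mono fun n hn => hn.eq_of_nhds.symm),
      tendsto_const_nhds.congr' (hev.mono fun n hn => hn.fderiv_eq.symm)⟩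

lemma tsupport_sub_comp_subset {X : Type*} [TopologicalSpace X] (φ : X → ℝ) (σ : X ≃ₜ X) :
    tsupport (fun x => φ x - φ (σ x)) ⊆ tsupport φ ∪ σ ⁻¹' tsupport φ := by
  refine closure_minimal (fun x hx => ?_)
    ((isClosed_tsupport φ).union ((isClosed_tsupport φ).preimage σ.continuous))
  by_contra h
  rw [mem_union, not_or] at h
  exact hx (by simp [image_eq_zero_of_notMem_tsupport h.1,
    image_eq_zero_of_notMem_tsupport (show σ x ∉ tsupport φ from h.2)])

lemma hasCompactSupport_sub_comp {X : Type*} [TopologicalSpace X] [T2Space X] {φ : X → ℝ}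
    (hφ : HasCompactSupport φ) (σ : X ≃ₜ X) : HasCompactSupport (fun x => φ x - φ (σ x)) :=
  .of_isClosed_subset (IsCompact.union hφ (σ.isCompact_preimage.2 hφ)) (isClosed_tsupport _)
    (tsupport_sub_comp_subset φ σ)

/-! ### Measures of the form `μ + S_* μ` -/

section AddMap

variable {α F : Type*} [MeasurableSpace α] [NormedAddCommGroup F] {μ : Measure α} {S : α → α}

lemma aestronglyMeasurable_add_map (hS : MeasurableEmbedding S) {f : α → F}
    (h : AEStronglyMeasurable f μ) (h' : AEStronglyMeasurable (fun x => f (S x)) μ) :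
    AEStronglyMeasurable f (μ + μ.map S) :=
  h.add_measure (hS.aestronglyMeasurable_map_iff.2 h')

lemma ae_add_map_iff (hS : MeasurableEmbedding S) {p : α → Prop} :
    (∀ᵐ x ∂(μ + μ.map S), p x) ↔ (∀ᵐ x ∂μ, p x) ∧ ∀ᵐ x ∂μ, p (S x) := by
  rw [ae_add_measure_iff, hS.ae_map_iff]

lemma exists_ae_norm_le_of_memLp_top {f : α → F} (h : MemLp f ⊤ μ) : ∃ C, ∀ᵐ x ∂μ, ‖f x‖ ≤ C :=
  by
  refine ⟨(eLpNorm f ⊤ μ).toReal, ?_⟩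
  filter_upwards [ae_le_eLpNormEssSup (f := f) (μ := μ)] with x hx
  rw [← eLpNorm_exponent_top] at hx
  simpa using ENNReal.toReal_mono h.2.ne hx

lemma memLp_top_add_map (hS : MeasurableEmbedding S) {f : α → F}
    (h : MemLp f ⊤ μ) (h' : MemLp (fun x => f (S x)) ⊤ μ) : MemLp f ⊤ (μ + μ.map S) := by
  obtain ⟨C, hC⟩ := exists_ae_norm_le_of_memLp_top h
  obtain ⟨C', hC'⟩ := exists_ae_norm_le_of_memLp_top h'
  refine memLp_top_of_bound (aestronglyMeasurable_add_map hS h.1 h'.1) (max C C')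
    ((ae_add_map_iff hS).2 ⟨?_, ?_⟩)
  · exact hC.mono fun x hx => hx.trans (le_max_left _ _)
  · exact hC'.mono fun x hx => hx.trans (le_max_right _ _)

/-- This is `√(a + b) ≤ √a + √b` applied to the two contributions to the squared norm. -/
lemma eLpNorm_two_add_map_le (hS : MeasurableEmbedding S) (f : α → F) :
    eLpNorm f 2 (μ + μ.map S) ≤ eLpNorm f 2 μ + eLpNorm (fun x => f (S x)) 2 μ := by
  simp only [eLpNorm_eq_lintegral_rpow_enorm_toReal two_ne_zero ENNReal.ofNat_ne_top]
  rw [lintegral_add_measure, hS.lintegral_map]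
  exact ENNReal.rpow_add_le_add_rpow _ _ (by norm_num) (by norm_num)

lemma memLp_two_add_map (hS : MeasurableEmbedding S) {f : α → F}
    (h : MemLp f 2 μ) (h' : MemLp (fun x => f (S x)) 2 μ) : MemLp f 2 (μ + μ.map S) :=
  ⟨aestronglyMeasurable_add_map hS h.1 h'.1,
    (eLpNorm_two_add_map_le hS f).trans_lt (ENNReal.add_lt_top.2 ⟨h.2, h'.2⟩)⟩

lemma integral_add_map [NormedSpace ℝ F] (hS : MeasurableEmbedding S) {f : α → F}
    (h : Integrable f μ) (h' : Integrable (fun x => f (S x)) μ) :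
    ∫ x, f x ∂(μ + μ.map S) = ∫ x, f x ∂μ + ∫ x, f (S x) ∂μ := by
  rw [integral_add_measure h (hS.integrable_map_iff.2 h'), hS.integral_map]

end AddMap

/-! ### Integrability of the transport term -/

lemma prod_restrict_univ (D : Set ℂ) :
    (volume : Measure (ℝ × ℂ)).restrict (univ ×ˢ D)
      = (volume : Measure ℝ).prod (volume.restrict D) := by
  rw [Measure.volume_eq_prod, ← Measure.prod_restrict, Measure.restrict_univ]

/-- On a finite measure space the `L²` bound gives an `L¹` bound in `x` by Cauchy–Schwarz, uniform
in `t`, which is integrable over times of finite measure. -/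
lemma integrable_prod_of_energy_bound {ν : Measure ℂ} [IsFiniteMeasure ν] {u : ℝ → ℂ → ℂ}
    {C : ℝ≥0} (hu : AEStronglyMeasurable (fun p : ℝ × ℂ => u p.1 p.2) (volume.prod ν))
    (hC : ∀ᵐ t : ℝ, eLpNorm (u t) 2 ν ≤ C) {s : Set ℝ} (hs : volume s ≠ ⊤) :
    Integrable (fun p : ℝ × ℂ => u p.1 p.2) ((volume.restrict s).prod ν) := by
  have hm : AEStronglyMeasurable (fun p : ℝ × ℂ => u p.1 p.2) ((volume.restrict s).prod ν) :=
    hu.mono_ac (Measure.AbsolutelyContinuous.prod Measure.restrict_le_self.absolutelyContinuous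
      .rfl)
  refine ⟨hm, ?_⟩
  rw [HasFiniteIntegral, lintegral_prod _ hm.enorm]
  calc ∫⁻ t in s, ∫⁻ x, ‖u t x‖ₑ ∂ν
      ≤ ∫⁻ _ in s, C * ν univ ^ (1 / 2 : ℝ) := by
        refine lintegral_mono_ae ?_
        filter_upwards [ae_restrict_of_ae hC, hm.prodMk_left] with t ht htm
        have := eLpNorm_le_eLpNorm_mul_rpow_measure_univ (p := 1) (q := 2) one_le_two htm
        rw [eLpNorm_one_eq_lintegral_enorm] at this
        refine this.trans ?_
        have he : (1 / (1 : ENNReal).toReal - 1 / (2 : ENNReal).toReal) = (1 / 2 : ℝ) := by norm_num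
        rw [he]
        gcongr
    _ < ⊤ := by
        rw [lintegral_const, Measure.restrict_apply_univ]
        exact ENNReal.mul_lt_top (ENNReal.mul_lt_top ENNReal.coe_lt_top
          (ENNReal.rpow_lt_top_of_nonneg (by norm_num) (measure_ne_top _ _))) hs.lt_top

/-- A common integrable bound for the transport terms `ω ∂φ(1, u)`, over all covector fields
bounded by `M` and supported in `|t| ≤ R`. -/
lemma exists_integrable_bound_transport {ν : Measure ℂ} [IsFiniteMeasure ν] {ω : ℝ → ℂ → ℝ}
    {u : ℝ → ℂ → ℂ} {C : ℝ≥0} (hω : MemLp (fun p : ℝ × ℂ => ω p.1 p.2) ⊤ (volume.prod ν))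
    (hu : AEStronglyMeasurable (fun p : ℝ × ℂ => u p.1 p.2) (volume.prod ν))
    (hC : ∀ᵐ t : ℝ, eLpNorm (u t) 2 ν ≤ C) (M R : ℝ) :
    ∃ b : ℝ × ℂ → ℝ, Integrable b (volume.prod ν) ∧
      ∀ G : ℝ × ℂ → ℝ × ℂ →L[ℝ] ℝ, Continuous G → (∀ p, ‖G p‖ ≤ M) → (∀ p, R < |p.1| → G p = 0) →
        AEStronglyMeasurable (fun p => ω p.1 p.2 * G p (1, u p.1 p.2)) (volume.prod ν) ∧
        ∀ᵐ p ∂(volume.prod ν), ‖ω p.1 p.2 * G p (1, u p.1 p.2)‖ ≤ b p := by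
  obtain ⟨W, hW⟩ := exists_ae_norm_le_of_memLp_top hω
  refine ⟨(Icc (-R) R ×ˢ univ).indicator fun p => W * (M * (1 + ‖u p.1 p.2‖)), ?_,
    fun G hG hGM hGR => ⟨?_, ?_⟩⟩
  · rw [integrable_indicator_iff (measurableSet_Icc.prod .univ), IntegrableOn,
      ← Measure.prod_restrict, Measure.restrict_univ]
    have h := integrable_prod_of_energy_bound hu hC (s := Icc (-R) R)
      measure_Icc_lt_top.ne
    exact (((integrable_const 1).add h.norm).const_mul M).const_mul W
  · refine hω.1.mul ?_
    exact isBoundedBilinearMap_apply.continuous.comp_aestronglyMeasurable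
      (hG.aestronglyMeasurable.prodMk (aestronglyMeasurable_const.prodMk hu))
  · filter_upwards [hW] with p hp
    by_cases h : R < |p.1|
    · rw [hGR p h]
      simp only [zero_apply, mul_zero, norm_zero]
      rw [indicator_of_notMem]
      simp only [mem_prod, mem_Icc, mem_univ, and_true]
      rw [← abs_le]; exact h.not_ge
    · have hmem : p ∈ Icc (-R) R ×ˢ (univ : Set ℂ) := ⟨abs_le.1 (not_lt.1 h), mem_univ _⟩
      rw [indicator_of_mem hmem, norm_mul]
      have hM0 : 0 ≤ M := (norm_nonneg _).trans (hGM p)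
      have hW0 : 0 ≤ W := (norm_nonneg _).trans hp
      gcongr
      refine ((G p).le_opNorm _).trans ?_
      gcongr
      · exact hGM p
      · rw [Prod.norm_def]
        simp only [norm_one]
        exact max_le (by linarith [norm_nonneg (u p.1 p.2)]) (by linarith)

/-- Convergence of the integrated transport terms. -/
lemma tendsto_integral_transport {ν : Measure ℂ} [IsFiniteMeasure ν] {ω : ℝ → ℂ → ℝ}
    {u : ℝ → ℂ → ℂ} {C : ℝ≥0} (hω : MemLp (fun p : ℝ × ℂ => ω p.1 p.2) ⊤ (volume.prod ν))
    (hu : AEStronglyMeasurable (fun p : ℝ × ℂ => u p.1 p.2) (volume.prod ν))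
    (hC : ∀ᵐ t : ℝ, eLpNorm (u t) 2 ν ≤ C) {M R : ℝ}
    {G : ℕ → ℝ × ℂ → ℝ × ℂ →L[ℝ] ℝ} {H : ℝ × ℂ → ℝ × ℂ →L[ℝ] ℝ}
    (hG : ∀ n, Continuous (G n)) (hGM : ∀ n p, ‖G n p‖ ≤ M)
    (hGR : ∀ n p, R < |p.1| → G n p = 0)
    (hlim : ∀ t, ∀ᵐ x ∂ν, Tendsto (fun n => G n (t, x)) atTop (𝓝 (H (t, x))))
    (s : Set ℝ) :
    Tendsto (fun n => ∫ t in s, ∫ x, ω t x * G n (t, x) (1, u t x) ∂ν) atTop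
      (𝓝 (∫ t in s, ∫ x, ω t x * H (t, x) (1, u t x) ∂ν)) := by
  obtain ⟨b, hb, hbG⟩ := exists_integrable_bound_transport hω hu hC M R
  have hac : (volume.restrict s).prod ν ≪ volume.prod ν :=
    Measure.AbsolutelyContinuous.prod Measure.restrict_le_self.absolutelyContinuous .rfl
  have hb' : Integrable b ((volume.restrict s).prod ν) := by
    have : (volume.restrict s).prod ν = (volume.prod ν).restrict (s ×ˢ univ) := by
      rw [← Measure.prod_restrict, Measure.restrict_univ]
    rw [this]; exact hb.restrict
  have hslice : ∀ᵐ t ∂(volume.restrict s), Integrable (fun x => b (t, x)) ν := hb'.prod_right_ae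
  -- Dominated convergence is used twice: in `x` with the slice of `b` as bound, then in `t` with
  -- the integral of that slice.
  refine tendsto_integral_of_dominated_convergence (fun t => ∫ x, b (t, x) ∂ν) (fun n => ?_)
    hb'.integral_prod_left (fun n => ?_) ?_
  · exact ((hbG _ (hG n) (hGM n) (hGR n)).1.mono_ac hac).integral_prod_right'
  · filter_upwards [hslice, Measure.ae_ae_of_ae_prod
      (hac.ae_le (hbG _ (hG n) (hGM n) (hGR n)).2)] with t ht h
    exact norm_integral_le_of_norm_le ht h
  · have hall : ∀ᵐ t ∂(volume.restrict s), ∀ n, (AEStronglyMeasurable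
        (fun x => ω t x * G n (t, x) (1, u t x)) ν ∧
        ∀ᵐ x ∂ν, ‖ω t x * G n (t, x) (1, u t x)‖ ≤ b (t, x)) := by
      rw [ae_all_iff]
      intro n
      obtain ⟨h1, h2⟩ := hbG _ (hG n) (hGM n) (hGR n)
      filter_upwards [(h1.mono_ac hac).prodMk_left, Measure.ae_ae_of_ae_prod (hac.ae_le h2)] with
        t ht ht' using ⟨ht, ht'⟩
    filter_upwards [hall, hslice] with t ht hbt
    refine tendsto_integral_of_dominated_convergence _ (fun n => (ht n).1) hbt (fun n => (ht n).2) ?_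
    filter_upwards [hlim t] with x hx
    exact ((((ContinuousLinearMap.apply ℝ ℝ ((1 : ℝ), u t x)).continuous.tendsto _).comp hx)).const_mul _

/-! ### Odd reflections of functions, gradients and velocities -/

open Classical in
/-- Reflection of a vector field on `D` to `S(D)`, multiplied there by `c`. -/
def vectorReflection (z w : ℂ) (D : Set ℂ) (c : ℝ) (g : ℂ → ℂ) : ℂ → ℂ := fun x =>
  if x ∈ D then g x
  else if x ∈ mirror z w '' D then c • mirrorLin z w (g (mirror z w x))
  else 0

variable {z w : ℂ} {D : Set ℂ} {y : ℂ → ℝ}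

lemma oddReflection_of_mem {f : ℂ → ℝ} {x : ℂ} (hx : x ∈ D) : oddReflection z w D f x = f x :=
  if_pos hx

lemma vectorReflection_of_mem {c : ℝ} {g : ℂ → ℂ} {x : ℂ} (hx : x ∈ D) :
    vectorReflection z w D c g x = g x := if_pos hx

namespace IsOneSided

variable (h : IsOneSided z w D y)
include h

lemma mirror_notMem {x : ℂ} (hx : x ∈ D) : mirror z w x ∉ D := fun hx' => by
  have := h.pos _ hx'
  rw [h.y_mirror] at this
  linarith [h.pos _ hx]

lemma oddReflection_mirror {f : ℂ → ℝ} {x : ℂ} (hx : x ∈ D) :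
    oddReflection z w D f (mirror z w x) = -f x := by
  rw [oddReflection, if_neg (h.mirror_notMem hx), if_pos (mem_image_of_mem _ hx), mirror_mirror]

lemma vectorReflection_mirror {c : ℝ} {g : ℂ → ℂ} {x : ℂ} (hx : x ∈ D) :
    vectorReflection z w D c g (mirror z w x) = c • mirrorLin z w (g x) := by
  rw [vectorReflection, if_neg (h.mirror_notMem hx), if_pos (mem_image_of_mem _ hx), mirror_mirror]

lemma disjoint_image : Disjoint D (mirror z w '' D) := Set.disjoint_left.2 fun _ hx hx' =>
  h.mirror_notMem hx (mem_mirror_image.1 hx')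

lemma isFiniteMeasure : IsFiniteMeasure (volume.restrict D) :=
  ⟨by rw [Measure.restrict_apply_univ]; exact h.volume_ne_top.lt_top⟩

lemma ae_mem : ∀ᵐ x ∂volume.restrict D, x ∈ D := ae_restrict_mem h.isOpen.measurableSet

lemma ae_doubled_iff {p : ℂ → Prop} : (∀ᵐ x ∂volume.restrict (doubled z w D), p x) ↔
    (∀ᵐ x ∂volume.restrict D, p x) ∧ ∀ᵐ x ∂volume.restrict D, p (mirror z w x) := by
  rw [h.restrict, ae_add_map_iff (measurableEmbedding_mirror z w)]

lemma contDiff_y : ContDiff ℝ ((⊤ : ℕ∞) : WithTop ℕ∞) y := by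
  obtain ⟨ℓ, hℓ⟩ := h.affine
  rw [funext hℓ]
  exact ℓ.contDiff.comp (contDiff_id.sub contDiff_const)

lemma exists_bound_fderiv_y : ∃ B, ∀ x, ‖fderiv ℝ y x‖ ≤ B := by
  obtain ⟨ℓ, hℓ⟩ := h.affine
  refine ⟨‖ℓ‖, fun x => ?_⟩
  have : HasFDerivAt y ℓ x := by
    rw [funext hℓ]
    exact (ℓ.hasFDerivAt.comp x ((hasFDerivAt_id x).sub_const z))
  rw [this.fderiv]

lemma mem_of_mirror_mem {x : ℂ} (hx : mirror z w x ∈ doubled z w D) (hy : 0 < y x) : x ∈ D :=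
  h.mem_of_pos x (by simpa [mirror_mirror] using h.mirror_mem _ hx) hy

lemma hasCompactEssSupport {f : ℂ → ℝ} (hf : HasCompactEssSupport D f) :
    HasCompactEssSupport (doubled z w D) (oddReflection z w D f) := by
  obtain ⟨K, hK, hKD, hf⟩ := hf
  refine ⟨K ∪ mirror z w '' K, hK.union (hK.image (continuous_mirror z w)),
    (union_subset_union hKD (image_mono hKD)).trans h.subset, h.ae_doubled_iff.2 ⟨?_, ?_⟩⟩
  · filter_upwards [hf, h.ae_mem] with x hx hxD hxK
    rw [oddReflection_of_mem hxD, hx fun hK => hxK (Or.inl hK)]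
  · filter_upwards [hf, h.ae_mem] with x hx hxD hxK
    rw [h.oddReflection_mirror hxD, hx fun hK => hxK (Or.inr (mem_image_of_mem _ hK)), neg_zero]

lemma memLinftyC {f : ℂ → ℝ} (hf : MemLinftyC D f) :
    MemLinftyC (doubled z w D) (oddReflection z w D f) := by
  refine ⟨?_, h.hasCompactEssSupport hf.compactSupport⟩
  rw [h.restrict]
  refine memLp_top_add_map (measurableEmbedding_mirror z w) (hf.memLp.ae_eq ?_)
    (hf.memLp.neg.ae_eq ?_)
  · filter_upwards [h.ae_mem] with x hx using (oddReflection_of_mem hx).symm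
  · filter_upwards [h.ae_mem] with x hx using (h.oddReflection_mirror hx).symm

/-! ### Space-time -/

omit h in
lemma measurableEmbedding_prodMap_mirror (z w : ℂ) :
    MeasurableEmbedding (Prod.map (id : ℝ → ℝ) (mirror z w)) :=
  ((Homeomorph.refl ℝ).prodCongr (mirrorHomeo z w)).measurableEmbedding

lemma restrict_univ_prod : (volume : Measure (ℝ × ℂ)).restrict (univ ×ˢ doubled z w D)
    = (volume : Measure ℝ).prod (volume.restrict D)
      + ((volume : Measure ℝ).prod (volume.restrict D)).map (Prod.map id (mirror z w)) := by
  have := h.isFiniteMeasure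
  rw [prod_restrict_univ, h.restrict, Measure.prod_add]
  congr 1
  have := Measure.map_prod_map (volume : Measure ℝ) (volume.restrict D) measurable_id
    (measurableEmbedding_mirror z w).measurable
  rwa [Measure.map_id] at this

lemma ae_prod_mem : ∀ᵐ p ∂((volume : Measure ℝ).prod (volume.restrict D)), p.2 ∈ D := by
  rw [← prod_restrict_univ]
  filter_upwards [ae_restrict_mem (MeasurableSet.univ.prod h.isOpen.measurableSet)] with p hp
    using hp.2

lemma memLinftyTimeLinftyC {ω : ℝ → ℂ → ℝ} (hω : MemLinftyTimeLinftyC D ω) :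
    MemLinftyTimeLinftyC (doubled z w D) (fun t => oddReflection z w D (ω t)) := by
  have hm := hω.memLp
  rw [prod_restrict_univ] at hm
  refine ⟨?_, hω.compactSupport.mono fun t ht => h.hasCompactEssSupport ht⟩
  rw [h.restrict_univ_prod]
  refine memLp_top_add_map (measurableEmbedding_prodMap_mirror z w) (hm.ae_eq ?_)
    (hm.neg.ae_eq ?_)
  · filter_upwards [h.ae_prod_mem] with p hp using (oddReflection_of_mem hp).symm
  · filter_upwards [h.ae_prod_mem] with p hp using (h.oddReflection_mirror hp).symm

lemma aestronglyMeasurable_vectorReflection {u : ℝ → ℂ → ℂ} {c : ℝ}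
    (hu : AEStronglyMeasurable (fun p : ℝ × ℂ => u p.1 p.2)
      ((volume : Measure ℝ).prod (volume.restrict D))) :
    AEStronglyMeasurable (fun p : ℝ × ℂ => vectorReflection z w D c (u p.1) p.2)
      (volume.restrict (univ ×ˢ doubled z w D)) := by
  rw [h.restrict_univ_prod]
  refine aestronglyMeasurable_add_map (measurableEmbedding_prodMap_mirror z w) (hu.congr ?_)
    ((((mirrorLin z w).continuous.comp_aestronglyMeasurable hu).const_smul c).congr ?_)
  · filter_upwards [h.ae_prod_mem] with p hp using (vectorReflection_of_mem hp).symm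
  · filter_upwards [h.ae_prod_mem] with p hp using (h.vectorReflection_mirror hp).symm

/-! ### The Dirichlet potential -/

lemma eLpNorm_doubled_le {F G : Type*} [NormedAddCommGroup F] [NormedAddCommGroup G] {f : ℂ → F}
    {g : ℂ → G} (h1 : ∀ x ∈ D, ‖f x‖ = ‖g x‖) (h2 : ∀ x ∈ D, ‖f (mirror z w x)‖ = ‖g x‖) :
    eLpNorm f 2 (volume.restrict (doubled z w D)) ≤ 2 * eLpNorm g 2 (volume.restrict D) := by
  rw [h.restrict, two_mul]
  refine (eLpNorm_two_add_map_le (measurableEmbedding_mirror z w) f).trans (le_of_eq ?_)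
  congr 1
  · exact eLpNorm_congr_norm_ae (h.ae_mem.mono h1)
  · exact eLpNorm_congr_norm_ae (h.ae_mem.mono h2)

omit h in
lemma gradient_sub_comp_mirror {φ : ℂ → ℝ} (hφ : Differentiable ℝ φ) (x : ℂ) :
    gradient (fun x => φ x - φ (mirror z w x)) x
      = gradient φ x - mirrorLin z w (gradient φ (mirror z w x)) := by
  refine HasGradientAt.gradient (hasGradientAt_iff_hasFDerivAt.2 ?_)
  have h1 := (hφ x).hasFDerivAt.sub ((hφ (mirror z w x)).hasFDerivAt.comp x
    (hasFDerivAt_mirror z w x))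
  refine h1.congr_fderiv ?_
  ext1 v
  simp only [map_sub, sub_apply, ContinuousLinearMap.comp_apply,
    InnerProductSpace.toDual_apply_apply, inner_mirrorLin, inner_gradient_left]
  rfl

omit h in
lemma fderiv_sub_comp_mirror {φ : ℂ → ℝ} (hφ : Differentiable ℝ φ) (x v : ℂ) :
    fderiv ℝ (fun x => φ x - φ (mirror z w x)) x v
      = fderiv ℝ φ x v - fderiv ℝ φ (mirror z w x) (mirrorLin z w v) := by
  rw [← inner_gradient_left, gradient_sub_comp_mirror hφ, inner_sub_left, inner_mirrorLin,
    inner_gradient_left, inner_gradient_left]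

omit h in
lemma contDiff_sub_comp_mirror {n : WithTop ℕ∞} {φ : ℂ → ℝ} (hφ : ContDiff ℝ n φ) :
    ContDiff ℝ n (fun x => φ x - φ (mirror z w x)) :=
  hφ.sub (hφ.comp (contDiff_mirror z w))

/-- The odd reflection of a test function on `D` is a test function on the doubled domain. -/
lemma isTest_sub_comp_mirror {φ : ℂ → ℝ} (hφ : IsTest D φ) :
    IsTest (doubled z w D) (fun x => φ x - φ (mirror z w x)) := by
  refine ⟨contDiff_sub_comp_mirror hφ.smooth,
    hasCompactSupport_sub_comp hφ.compact (mirrorHomeo z w),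
    (tsupport_sub_comp_subset φ (mirrorHomeo z w)).trans (Subset.trans ?_ h.subset)⟩
  exact union_subset_union hφ.supp fun x hx => mem_mirror_image.2 (hφ.supp hx)

/-- If `φ n` approximates `ψ`, then `φ n - φ n ∘ S` approximates its odd reflection. On each half
only one of the two terms survives, since `φ n` is supported in `D`, and the errors on the two
halves have equal norms because the reflection is an isometry. -/
lemma isH10WithGradient {ψ : ℂ → ℝ} {g : ℂ → ℂ} (hψ : IsH10WithGradient D ψ g) :
    IsH10WithGradient (doubled z w D) (oddReflection z w D ψ)
      (vectorReflection z w D (-1) g) := by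
  obtain ⟨hψ2, hg2, φ, hφ, hlim, hlim'⟩ := hψ
  have hout : ∀ n, ∀ x ∈ D, mirror z w x ∉ tsupport (φ n) := fun n x hx hx' =>
    h.mirror_notMem hx ((hφ n).supp hx')
  have hgrad : ∀ n, ∀ x ∈ D, gradient (φ n) (mirror z w x) = 0 := fun n x hx => by
    rw [gradient, fderiv_of_notMem_tsupport ℝ (hout n x hx), map_zero]
  have hdiff : ∀ n, Differentiable ℝ (φ n) := fun n => (hφ n).smooth.differentiable (by simp)
  have htwo : Tendsto (fun a : ENNReal => 2 * a) (𝓝 0) (𝓝 0) := by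
    simpa using ENNReal.Tendsto.const_mul (tendsto_id (x := 𝓝 (0 : ENNReal)))
      (Or.inr (ENNReal.ofNat_ne_top (n := 2)))
  refine ⟨?_, ?_, fun n x => φ n x - φ n (mirror z w x), fun n => h.isTest_sub_comp_mirror (hφ n),
    tendsto_of_tendsto_of_tendsto_of_le_of_le tendsto_const_nhds (htwo.comp hlim)
      (fun _ => zero_le) fun n => h.eLpNorm_doubled_le (fun x hx => ?_) fun x hx => ?_,
    tendsto_of_tendsto_of_tendsto_of_le_of_le tendsto_const_nhds (htwo.comp hlim')
      (fun _ => zero_le) fun n => h.eLpNorm_doubled_le (fun x hx => ?_) fun x hx => ?_⟩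
  · rw [h.restrict]
    refine memLp_two_add_map (measurableEmbedding_mirror z w) (hψ2.ae_eq ?_) (hψ2.neg.ae_eq ?_)
    · filter_upwards [h.ae_mem] with x hx using (oddReflection_of_mem hx).symm
    · filter_upwards [h.ae_mem] with x hx using (h.oddReflection_mirror hx).symm
  · rw [h.restrict]
    refine memLp_two_add_map (measurableEmbedding_mirror z w) (hg2.ae_eq ?_)
      ((((mirrorLin z w : ℂ ≃L[ℝ] ℂ) : ℂ →L[ℝ] ℂ).comp_memLp' hg2).const_smul (-1 : ℝ)
        |>.ae_eq ?_)
    · filter_upwards [h.ae_mem] with x hx using (vectorReflection_of_mem hx).symm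
    · filter_upwards [h.ae_mem] with x hx using (h.vectorReflection_mirror hx).symm
  · beta_reduce
    rw [oddReflection_of_mem hx, image_eq_zero_of_notMem_tsupport (hout n x hx), sub_zero]
  · beta_reduce
    rw [h.oddReflection_mirror hx, image_eq_zero_of_notMem_tsupport (hout n x hx), mirror_mirror,
      ← norm_neg]
    congr 1; ring
  · rw [vectorReflection_of_mem hx, gradient_sub_comp_mirror (hdiff n), hgrad n x hx, map_zero,
      sub_zero]
  · rw [h.vectorReflection_mirror hx, gradient_sub_comp_mirror (hdiff n), hgrad n x hx,
      mirror_mirror, ← (mirrorLin z w).norm_map (gradient (φ n) x - g x), ← norm_neg, map_sub]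
    congr 1; module

/-- Odd parts of test functions on the doubled domain are `C¹`-bounded pointwise limits of test
functions on `D`. -/
lemma exists_isTest_tendsto {φ : ℂ → ℝ} (hφ : IsTest (doubled z w D) φ) :
    ∃ (θ : ℕ → ℂ → ℝ) (M : ℝ), (∀ n, IsTest D (θ n)) ∧
      (∀ n x, |θ n x| ≤ M) ∧ (∀ n x, ‖fderiv ℝ (θ n) x‖ ≤ M) ∧
      ∀ x ∈ D, Tendsto (fun n => θ n x) atTop (𝓝 (φ x - φ (mirror z w x))) ∧
        Tendsto (fun n => fderiv ℝ (θ n) x) atTop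
          (𝓝 (fderiv ℝ (fun x => φ x - φ (mirror z w x)) x)) := by
  obtain ⟨B, hB⟩ := h.exists_bound_fderiv_y
  obtain ⟨C, hC0, hC⟩ := h.norm_sub_le
  obtain ⟨K, hK⟩ := hφ.smooth.lipschitzWith_of_hasCompactSupport hφ.compact (by simp)
  have hηc := hasCompactSupport_sub_comp hφ.compact (mirrorHomeo z w)
  have hηC : ∀ x, |φ x - φ (mirror z w x)| ≤ (K * C) * |y x| := fun x => by
    have := hK.dist_le_mul x (mirror z w x)
    rw [dist_eq_norm, dist_eq_norm] at this
    refine this.trans ?_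
    rw [mul_assoc]; gcongr; exact hC x
  obtain ⟨θ, M, hθs, hθt, hθM, hθM', hlim⟩ :=
    exists_cutoff (contDiff_sub_comp_mirror hφ.smooth) hηc hηC h.contDiff_y hB
  -- The support of the odd part lies in the doubled domain, which is symmetric; its part in `{0 <
  -- y}` lies in `D`.
  have hsub : ∀ n, tsupport (θ n) ⊆ D := fun n x hx => by
    obtain ⟨hx1, hx2⟩ := hθt n hx
    rcases tsupport_sub_comp_subset φ (mirrorHomeo z w) hx1 with hx1 | hx1
    · exact h.mem_of_pos x (hφ.supp hx1) hx2
    · exact h.mem_of_mirror_mem (hφ.supp hx1) hx2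
  exact ⟨θ, M, fun n => ⟨hθs n, hηc.of_isClosed_subset (isClosed_tsupport _)
    ((hθt n).trans inter_subset_left), hsub n⟩, hθM, hθM', fun x hx => hlim x (h.pos x hx)⟩

lemma integral_doubled {F : ℂ → ℝ} {f f' : ℂ → ℝ} (hf : Integrable f (volume.restrict D))
    (hf' : Integrable f' (volume.restrict D)) (h1 : ∀ x ∈ D, F x = f x)
    (h2 : ∀ x ∈ D, F (mirror z w x) = f' x) :
    ∫ x in doubled z w D, F x = ∫ x in D, (f x + f' x) := by
  have e1 : f =ᵐ[volume.restrict D] F := h.ae_mem.mono fun x hx => (h1 x hx).symm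
  have e2 : f' =ᵐ[volume.restrict D] fun x => F (mirror z w x) :=
    h.ae_mem.mono fun x hx => (h2 x hx).symm
  rw [h.restrict, integral_add_map (measurableEmbedding_mirror z w) (hf.congr e1) (hf'.congr e2),
    integral_add hf hf', integral_congr_ae e1, integral_congr_ae e2]

/-- The change of variables `x ↦ S x` on the mirror half moves the reflection from `f` to `φ`. -/
lemma integral_mul_doubled {f φ : ℂ → ℝ} (hf : Integrable f (volume.restrict D))
    (hφ : Continuous φ) (hφc : HasCompactSupport φ) :
    ∫ x in doubled z w D, oddReflection z w D f x * φ x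
      = ∫ x in D, f x * (φ x - φ (mirror z w x)) := by
  obtain ⟨M, hM⟩ := hφc.exists_bound_of_continuous hφ
  rw [h.integral_doubled (f := fun x => f x * φ x) (f' := fun x => -(f x * φ (mirror z w x)))]
  · congr 1; ext x; ring
  · exact hf.mul_bdd (c := M) hφ.aestronglyMeasurable (.of_forall hM)
  · exact (hf.mul_bdd (c := M) (hφ.comp (continuous_mirror z w)).aestronglyMeasurable
      (.of_forall fun x => hM _)).neg
  · intro x hx; rw [oddReflection_of_mem hx]
  · intro x hx; rw [h.oddReflection_mirror hx]; ring

omit h in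
lemma tendsto_integral_mul {f : ℂ → ℝ} (hf : Integrable f (volume.restrict D))
    (hD : ∀ᵐ x ∂volume.restrict D, x ∈ D) {θ : ℕ → ℂ → ℝ} {η : ℂ → ℝ} {M : ℝ}
    (hθ : ∀ n, Continuous (θ n)) (hM : ∀ n x, |θ n x| ≤ M)
    (hlim : ∀ x ∈ D, Tendsto (fun n => θ n x) atTop (𝓝 (η x))) :
    Tendsto (fun n => ∫ x in D, f x * θ n x) atTop (𝓝 (∫ x in D, f x * η x)) := by
  refine tendsto_integral_of_dominated_convergence (fun x => ‖f x‖ * M)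
    (fun n => hf.1.mul (hθ n).aestronglyMeasurable) (hf.norm.mul_const M)
    (fun n => .of_forall fun x => ?_) (hD.mono fun x hx => (hlim x hx).const_mul _)
  rw [norm_mul]; gcongr; exact hM n x

lemma isDirichletPotential {ω ψ : ℂ → ℝ} {g : ℂ → ℂ} (hω : Integrable ω (volume.restrict D))
    (hψ : IsDirichletPotential D ω ψ g) :
    IsDirichletPotential (doubled z w D) (oddReflection z w D ω) (oddReflection z w D ψ)
      (vectorReflection z w D (-1) g) := by
  have := h.isFiniteMeasure
  refine ⟨h.isH10WithGradient hψ.1, fun φ hφ => ?_⟩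
  have hg : Integrable g (volume.restrict D) := hψ.1.2.1.integrable one_le_two
  have hφd : Differentiable ℝ φ := hφ.smooth.differentiable (by simp)
  have hinner : ∀ (φ : ℂ → ℝ) (x v : ℂ), inner ℝ v (gradient φ x) = fderiv ℝ φ x v :=
    fun φ x v => by rw [inner_gradient_right]; simp
  have hpot := hψ.2
  simp only [hinner] at hpot ⊢
  have hint : ∀ χ : ℂ → ℝ, ContDiff ℝ ((⊤ : ℕ∞) : WithTop ℕ∞) χ → HasCompactSupport χ →
      Integrable (fun x => fderiv ℝ χ x (g x)) (volume.restrict D) := fun χ hχ hχc => by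
    have hc : Continuous (fderiv ℝ χ) := hχ.continuous_fderiv (by simp)
    obtain ⟨M, hM⟩ := (hχc.fderiv (𝕜 := ℝ)).exists_bound_of_continuous hc
    refine (hg.norm.const_mul M).mono' (isBoundedBilinearMap_apply.continuous.comp_aestronglyMeasurable
      (hc.aestronglyMeasurable.prodMk hg.1)) (.of_forall fun x => ?_)
    exact ((fderiv ℝ χ x).le_opNorm _).trans (by gcongr; exact hM x)
  set η : ℂ → ℝ := fun x => φ x - φ (mirror z w x) with hη
  have hηs : ContDiff ℝ ((⊤ : ℕ∞) : WithTop ℕ∞) η := contDiff_sub_comp_mirror hφ.smooth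
  have hηc : HasCompactSupport η := hasCompactSupport_sub_comp hφ.compact (mirrorHomeo z w)
  -- The weak equation on `D`, extended to the inadmissible test function `η` by passing to the
  -- limit along `θ n`.
  have hkey : ∫ x in D, fderiv ℝ η x (g x) = -∫ x in D, ω x * η x := by
    obtain ⟨θ, M, hθ, hM, hM', hlim⟩ := h.exists_isTest_tendsto hφ
    have t1 := tendsto_integral_mul hω h.ae_mem (fun n => (hθ n).smooth.continuous) hM
      fun x hx => (hlim x hx).1
    have t2 : Tendsto (fun n => ∫ x in D, fderiv ℝ (θ n) x (g x)) atTop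
        (𝓝 (∫ x in D, fderiv ℝ η x (g x))) := by
      refine tendsto_integral_of_dominated_convergence (fun x => M * ‖g x‖)
        (fun n => (hint _ (hθ n).smooth (hθ n).compact).1) (hg.norm.const_mul M)
        (fun n => .of_forall fun x => ?_) (h.ae_mem.mono fun x hx => ?_)
      · exact ((fderiv ℝ (θ n) x).le_opNorm _).trans (by gcongr; exact hM' n x)
      · exact ((ContinuousLinearMap.apply ℝ ℝ (g x)).continuous.tendsto _).comp (hlim x hx).2
    refine tendsto_nhds_unique t2 (t1.neg.congr fun n => ?_)
    exact (hpot _ (hθ n)).symm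
  -- At `S x` the reflected gradient is `-L g`, with `L` the linear part of `S`, and `dφ(S x)(-L g)
  -- = dη(g) - dφ(g)`. Added to the contribution `dφ(g)` of `D`, this leaves `dη(g)`.
  rw [h.integral_mul_doubled hω hφ.smooth.continuous hφ.compact, ← hkey,
    h.integral_doubled (f := fun x => fderiv ℝ φ x (g x))
      (f' := fun x => fderiv ℝ η x (g x) - fderiv ℝ φ x (g x))]
  · congr 1; ext x; ring
  · exact hint φ hφ.smooth hφ.compact
  · exact (hint η hηs hηc).sub (hint φ hφ.smooth hφ.compact)
  · intro x hx; rw [vectorReflection_of_mem hx]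
  · intro x hx
    rw [h.vectorReflection_mirror hx, hη, fderiv_sub_comp_mirror hφd]
    simp

/-- The factor `-1` on the reflected gradient becomes `+1` on the velocity because `i` anticommutes
with the linear reflection. -/
lemma isVelocity {ω : ℂ → ℝ} {u : ℂ → ℂ} (hω : Integrable ω (volume.restrict D))
    (hu : IsVelocity D ω u) :
    IsVelocity (doubled z w D) (oddReflection z w D ω) (vectorReflection z w D 1 u) := by
  obtain ⟨ψ, g, hψ, hug⟩ := hu
  refine ⟨_, _, h.isDirichletPotential hω hψ, h.ae_doubled_iff.2 ⟨?_, ?_⟩⟩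
  · filter_upwards [hug, h.ae_mem] with x hx hxD
    rw [vectorReflection_of_mem hxD, vectorReflection_of_mem hxD, hx]
  · filter_upwards [hug, h.ae_mem] with x hx hxD
    rw [h.vectorReflection_mirror hxD, h.vectorReflection_mirror hxD, hx, mirrorLin_I_mul h.ne]
    simp

/-! ### The Euler equations -/

omit h in
lemma contDiff_prodMap_mirror {n : WithTop ℕ∞} (z w : ℂ) :
    ContDiff ℝ n (Prod.map (id : ℝ → ℝ) (mirror z w)) :=
  contDiff_id.prodMap (contDiff_mirror z w)

omit h in
lemma contDiff_sub_comp_prodMap_mirror {n : WithTop ℕ∞} {φ : ℝ × ℂ → ℝ} (hφ : ContDiff ℝ n φ) :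
    ContDiff ℝ n (fun p => φ p - φ (Prod.map id (mirror z w) p)) :=
  hφ.sub (hφ.comp (contDiff_prodMap_mirror z w))

omit h in
lemma fderiv_sub_comp_prodMap_mirror {φ : ℝ × ℂ → ℝ} (hφ : Differentiable ℝ φ) (t a : ℝ)
    (x v : ℂ) :
    fderiv ℝ (fun p => φ p - φ (Prod.map id (mirror z w) p)) (t, x) (a, v)
      = fderiv ℝ φ (t, x) (a, v) - fderiv ℝ φ (t, mirror z w x) (a, mirrorLin z w v) := by
  have h1 : HasFDerivAt (Prod.map (id : ℝ → ℝ) (mirror z w)) _ (t, x) :=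
    (hasFDerivAt_id t).prodMap (t, x) (hasFDerivAt_mirror z w x)
  have h2 := (hφ (t, x)).hasFDerivAt.sub
    ((hφ (Prod.map id (mirror z w) (t, x))).hasFDerivAt.comp (t, x) h1)
  have h3 : HasFDerivAt (fun p => φ p - φ (Prod.map id (mirror z w) p)) _ (t, x) := h2
  rw [h3.fderiv]
  rfl

/-- Odd parts of space-time test functions on the doubled domain are `C¹`-bounded pointwise limits
of space-time test functions on `D`. -/
lemma exists_isSpaceTimeTest_tendsto {φ : ℝ × ℂ → ℝ} (hφ : IsSpaceTimeTest (doubled z w D) φ) :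
    ∃ (θ : ℕ → ℝ × ℂ → ℝ) (M R : ℝ), (∀ n, IsSpaceTimeTest D (θ n)) ∧
      (∀ n p, |θ n p| ≤ M) ∧ (∀ n p, ‖fderiv ℝ (θ n) p‖ ≤ M) ∧
      (∀ n p, R < |p.1| → fderiv ℝ (θ n) p = 0) ∧
      ∀ p : ℝ × ℂ, p.2 ∈ D →
        Tendsto (fun n => θ n p) atTop (𝓝 (φ p - φ (Prod.map id (mirror z w) p))) ∧
        Tendsto (fun n => fderiv ℝ (θ n) p) atTop
          (𝓝 (fderiv ℝ (fun p => φ p - φ (Prod.map id (mirror z w) p)) p)) := by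
  obtain ⟨B, hB⟩ := h.exists_bound_fderiv_y
  obtain ⟨C, hC0, hC⟩ := h.norm_sub_le
  obtain ⟨K, hK⟩ := hφ.smooth.lipschitzWith_of_hasCompactSupport hφ.compact (by simp)
  set σ := (Homeomorph.refl ℝ).prodCongr (mirrorHomeo z w)
  have hηc := hasCompactSupport_sub_comp hφ.compact σ
  have hηC : ∀ p : ℝ × ℂ, |φ p - φ (Prod.map id (mirror z w) p)| ≤ (K * C) * |y p.2| :=
    fun p => by
    have := hK.dist_le_mul p (Prod.map id (mirror z w) p)
    rw [dist_eq_norm, dist_eq_norm] at this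
    refine this.trans ?_
    rw [mul_assoc]
    gcongr
    simp only [Prod.norm_def, Prod.fst_sub, Prod.snd_sub, Prod.map_fst, Prod.map_snd, id, sub_self,
      norm_zero]
    exact max_le (by positivity) (hC p.2)
  have hy : ContDiff ℝ ((⊤ : ℕ∞) : WithTop ℕ∞) (fun p : ℝ × ℂ => y p.2) :=
    h.contDiff_y.comp contDiff_snd
  have hyB : ∀ p : ℝ × ℂ, ‖fderiv ℝ (fun p : ℝ × ℂ => y p.2) p‖
      ≤ B * ‖ContinuousLinearMap.snd ℝ ℝ ℂ‖ := fun p => by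
    have := ((h.contDiff_y.differentiable (by simp)) p.2).hasFDerivAt.comp p
      (hasFDerivAt_snd (𝕜 := ℝ) (p := p))
    have h' : HasFDerivAt (fun p : ℝ × ℂ => y p.2) _ p := this
    rw [h'.fderiv]
    refine (ContinuousLinearMap.opNorm_comp_le _ _).trans ?_
    gcongr; exact hB _
  obtain ⟨θ, M, hθs, hθt, hθM, hθM', hlim⟩ :=
    exists_cutoff (contDiff_sub_comp_prodMap_mirror hφ.smooth) hηc hηC hy hyB
  have hsub : ∀ n, tsupport (θ n) ⊆ univ ×ˢ D := fun n p hp => by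
    obtain ⟨hp1, hp2⟩ := hθt n hp
    refine ⟨mem_univ _, ?_⟩
    rcases tsupport_sub_comp_subset φ σ hp1 with hp1 | hp1
    · exact h.mem_of_pos _ (hφ.supp hp1).2 hp2
    · exact h.mem_of_mirror_mem (hφ.supp hp1).2 hp2
  obtain ⟨R, hR⟩ := hηc.isBounded.subset_closedBall 0
  refine ⟨θ, M, R, fun n => ⟨hθs n, hηc.of_isClosed_subset (isClosed_tsupport _)
    ((hθt n).trans inter_subset_left), hsub n⟩, hθM, hθM', fun n p hp =>
    fderiv_of_notMem_tsupport ℝ fun hp' => ?_, fun p hp => hlim p (h.pos _ hp)⟩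
  have := hR (hθt n hp').1
  rw [mem_closedBall_zero_iff] at this
  exact hp.not_ge ((norm_fst_le p).trans this)

lemma eLpNorm_vectorReflection_le (u : ℂ → ℂ) :
    eLpNorm (vectorReflection z w D 1 u) 2 (volume.restrict (doubled z w D))
      ≤ 2 * eLpNorm u 2 (volume.restrict D) :=
  h.eLpNorm_doubled_le (fun x hx => by rw [vectorReflection_of_mem hx])
    fun x hx => by rw [h.vectorReflection_mirror hx, one_smul, LinearIsometryEquiv.norm_map]

lemma isGlobalWeakSolution {ω₀ : ℂ → ℝ} (hω₀ : MemLinftyC D ω₀) {ω : ℝ → ℂ → ℝ}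
    (hω : IsGlobalWeakSolution D ω₀ ω) :
    IsGlobalWeakSolution (doubled z w D) (oddReflection z w D ω₀)
      (fun t => oddReflection z w D (ω t)) := by
  have := h.isFiniteMeasure
  obtain ⟨hmem, u, hu, ⟨C, hC⟩, hvel, hweak⟩ := hω
  have hωm := hmem.memLp
  rw [prod_restrict_univ] at hu hωm
  have hω₀i : Integrable ω₀ (volume.restrict D) := hω₀.memLp.integrable le_top
  have hωi : ∀ᵐ t : ℝ, Integrable (ω t) (volume.restrict D) := by
    obtain ⟨W, hW⟩ := exists_ae_norm_le_of_memLp_top hωm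
    filter_upwards [hωm.1.prodMk_left, Measure.ae_ae_of_ae_prod hW] with t ht ht'
    exact (memLp_top_of_bound ht W ht').integrable le_top
  refine ⟨h.memLinftyTimeLinftyC hmem, fun t => vectorReflection z w D 1 (u t),
    h.aestronglyMeasurable_vectorReflection hu, ⟨2 * C, ?_⟩, ?_, fun φ hφ => ?_⟩
  · filter_upwards [hC] with t ht
    refine (h.eLpNorm_vectorReflection_le (u t)).trans ?_
    push_cast
    gcongr
  · filter_upwards [hvel, hωi] with t ht hti using h.isVelocity hti ht
  obtain ⟨θ, M, R, hθ, hθM, hθM', hθR, hlim⟩ := h.exists_isSpaceTimeTest_tendsto hφ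
  set η : ℝ × ℂ → ℝ := fun p => φ p - φ (Prod.map id (mirror z w) p) with hη
  have hηs : ContDiff ℝ ((⊤ : ℕ∞) : WithTop ℕ∞) η := contDiff_sub_comp_prodMap_mirror hφ.smooth
  have hηc : HasCompactSupport η :=
    hasCompactSupport_sub_comp hφ.compact ((Homeomorph.refl ℝ).prodCongr (mirrorHomeo z w))
  have hint : ∀ χ : ℝ × ℂ → ℝ, ContDiff ℝ ((⊤ : ℕ∞) : WithTop ℕ∞) χ → HasCompactSupport χ →
      ∀ᵐ t : ℝ, Integrable (fun x => ω t x * fderiv ℝ χ (t, x) (1, u t x))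
        (volume.restrict D) := fun χ hχ hχc => by
    have hc : Continuous (fderiv ℝ χ) := hχ.continuous_fderiv (by simp)
    obtain ⟨A, hA⟩ := (hχc.fderiv (𝕜 := ℝ)).exists_bound_of_continuous hc
    obtain ⟨S, hS⟩ := hχc.isBounded.subset_closedBall 0
    obtain ⟨b, hb, hbG⟩ := exists_integrable_bound_transport hωm hu hC A S
    obtain ⟨h1, h2⟩ := hbG _ hc hA fun p hp => fderiv_of_notMem_tsupport ℝ fun hp' => by
      have := hS hp'
      rw [mem_closedBall_zero_iff] at this
      exact hp.not_ge ((norm_fst_le p).trans this)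
    exact (hb.mono' h1 h2).prod_right_ae
  -- On the mirror half the vorticity changes sign while the velocity is carried along by the
  -- reflection, so the integrand there is `-ω dφ(t, S x)(1, L u) = ω (dη - dφ)(1, u)`.
  have hred : ∀ s : Set ℝ,
      ∫ t in s, ∫ x in doubled z w D, oddReflection z w D (ω t) x *
          fderiv ℝ φ (t, x) (1, vectorReflection z w D 1 (u t) x)
        = ∫ t in s, ∫ x in D, ω t x * fderiv ℝ η (t, x) (1, u t x) := fun s => by
    refine integral_congr_ae (ae_restrict_of_ae ?_)
    filter_upwards [hint φ hφ.smooth hφ.compact, hint η hηs hηc] with t h1 h2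
    rw [h.integral_doubled h1 (h2.sub h1)]
    · congr 1; ext x; simp
    · intro x hx; rw [oddReflection_of_mem hx, vectorReflection_of_mem hx]
    · intro x hx
      rw [h.oddReflection_mirror hx, h.vectorReflection_mirror hx, Pi.sub_apply, hη,
        fderiv_sub_comp_prodMap_mirror (hφ.smooth.differentiable (by simp)), one_smul]
      ring
  have hslice : HasCompactSupport fun x => φ (0, x) := by
    refine .of_isClosed_subset (IsCompact.image hφ.compact continuous_snd) (isClosed_tsupport _)
      (closure_minimal (fun x hx => ⟨(0, x), subset_tsupport _ hx, rfl⟩)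
        (IsCompact.image hφ.compact continuous_snd).isClosed)
  have hinit : ∫ x in doubled z w D, oddReflection z w D ω₀ x * φ (0, x)
      = ∫ x in D, ω₀ x * η (0, x) :=
    h.integral_mul_doubled hω₀i (hφ.smooth.continuous.comp (by fun_prop)) hslice
  have l0 : Tendsto (fun n => ∫ x in D, ω₀ x * θ n (0, x)) atTop
      (𝓝 (∫ x in D, ω₀ x * η (0, x))) :=
    tendsto_integral_mul hω₀i h.ae_mem
      (fun n => (hθ n).smooth.continuous.comp (by fun_prop : Continuous fun x : ℂ => ((0 : ℝ), x)))
      (fun n x => hθM n _) fun x hx => (hlim (0, x) hx).1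
  have l1 := tendsto_integral_transport hωm hu hC
    (fun n => (hθ n).smooth.continuous_fderiv (by simp)) hθM' hθR
    (fun t => h.ae_mem.mono fun x hx => (hlim (t, x) hx).2)
  rw [hred, hred, hinit]
  -- The left-hand sides for `θ n` converge to those for `η` and are zero for every `n`.
  exact ⟨tendsto_nhds_unique ((l1 (Ioi 0)).add l0)
      (tendsto_const_nhds.congr fun n => ((hweak _ (hθ n)).1).symm),
    tendsto_nhds_unique ((l1 (Iio 0)).sub l0)
      (tendsto_const_nhds.congr fun n => ((hweak _ (hθ n)).2).symm)⟩

/-! ### Periodic solutions: counter-rotating pairs and patch pairs. -/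

lemma oddReflection_mirror_apply (f : ℂ → ℝ) (x : ℂ) :
    oddReflection z w D f (mirror z w x) = -oddReflection z w D f x := by
  by_cases hx : x ∈ D
  · rw [h.oddReflection_mirror hx, oddReflection_of_mem hx]
  · by_cases hx' : mirror z w x ∈ D
    · have := h.oddReflection_mirror (f := f) hx'
      rw [mirror_mirror] at this
      rw [this, neg_neg, oddReflection_of_mem hx']
    · rw [oddReflection, oddReflection, if_neg hx', if_neg hx, if_neg (mem_mirror_image.not.2 hx'),
        if_neg (mem_mirror_image.not.2 (by rwa [mirror_mirror])), neg_zero]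

lemma isPeriodicCounterRotatingPair {T : ℝ} {ω : ℝ → ℂ → ℝ} (hω : IsTimePeriodic D T ω) :
    IsPeriodicCounterRotatingPair z w D T (fun t => oddReflection z w D (ω t)) := by
  refine ⟨h.disjoint_image, h.subset, fun t => .of_forall fun x hx => ?_,
    fun t => .of_forall fun x => h.oddReflection_mirror_apply _ x,
    hω.1, fun t => h.ae_doubled_iff.2 ⟨?_, ?_⟩⟩
  · rw [mem_union, not_or] at hx
    simp [oddReflection, hx.1, hx.2]
  · filter_upwards [hω.2 t, h.ae_mem] with x hx hxD
    rw [oddReflection_of_mem hxD, oddReflection_of_mem hxD, hx]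
  · filter_upwards [hω.2 t, h.ae_mem] with x hx hxD
    rw [h.oddReflection_mirror hxD, h.oddReflection_mirror hxD, hx]

lemma isPeriodicPatchPair {T Γ : ℝ} {A : ℝ → Set ℂ} {ω : ℝ → ℂ → ℝ}
    (hω : IsPeriodicPatch D T Γ A ω) :
    IsPeriodicPatchPair (doubled z w D) T Γ A (fun t => mirror z w '' A t)
      (fun t => oddReflection z w D (ω t)) := by
  have hA := hω.subset
  refine ⟨hω.pos, fun t => ⟨hω.measurable t,
      (measurableEmbedding_mirror z w).measurableSet_image.2 (hω.measurable t)⟩,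
    fun t => ⟨(hA t).trans (subset_union_left.trans h.subset),
      (image_mono (hA t)).trans (subset_union_right.trans h.subset)⟩,
    fun t => h.disjoint_image.mono (hA t) (image_mono (hA t)),
    fun t => ⟨hω.periodic t, by rw [hω.periodic t]⟩, fun t => h.ae_doubled_iff.2 ⟨?_, ?_⟩⟩
  · filter_upwards [hω.eq t, h.ae_mem] with x hx hxD
    have hx' : x ∉ mirror z w '' A t := fun hx' =>
      h.mirror_notMem hxD (hA t (mem_mirror_image.1 hx'))
    rw [oddReflection_of_mem hxD, hx, indicator_of_notMem hx', sub_zero]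
  · filter_upwards [hω.eq t, h.ae_mem] with x hx hxD
    have hx' : mirror z w x ∉ A t := fun hx' => h.mirror_notMem hxD (hA t hx')
    rw [h.oddReflection_mirror hxD, hx, indicator_of_notMem hx', zero_sub]
    congr 1
    by_cases hxA : x ∈ A t
    · rw [indicator_of_mem hxA, indicator_of_mem (mem_image_of_mem _ hxA)]
    · rw [indicator_of_notMem hxA, indicator_of_notMem]
      rwa [mem_mirror_image, mirror_mirror]

end IsOneSided

end EulerDuplication

end

open EulerDuplication in
theorem proposition6p1 (D : Set ℂ) (hD_open : IsOpen D) (hD_bdd : Bornology.IsBounded D)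
    (hD_sc : IsSimplyConnected D)
    (hD_reg : interior (closure D) = D)
    (z w : ℂ) (hzw : z ≠ w)
    (hseg : frontier D ∩ (affineSpan ℝ ({z, w} : Set ℂ) : Set ℂ) = segment ℝ z w)
    (ω₀ : ℂ → ℝ) (hω₀ : MemLinftyC D ω₀)
    (ω : ℝ → ℂ → ℝ) (hω : IsGlobalWeakSolution D ω₀ ω) :
    MemLinftyC (doubled z w D) (oddReflection z w D ω₀) ∧
    IsGlobalWeakSolution (doubled z w D) (oddReflection z w D ω₀)
      (fun t => oddReflection z w D (ω t)) ∧
    (∀ T : ℝ, IsTimePeriodic D T ω →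
      IsPeriodicCounterRotatingPair z w D T (fun t => oddReflection z w D (ω t))) ∧
    (∀ (T Γ : ℝ) (A : ℝ → Set ℂ), IsPeriodicPatch D T Γ A ω →
      IsPeriodicPatchPair (doubled z w D) T Γ A (fun t => mirror z w '' A t)
        (fun t => oddReflection z w D (ω t))) := by
  obtain ⟨y, h⟩ := exists_isOneSided hD_open hD_bdd hD_sc hD_reg hzw hseg
  exact ⟨h.memLinftyC hω₀, h.isGlobalWeakSolution hω₀ hω,
    fun _ hT => h.isPeriodicCounterRotatingPair hT, fun _ _ _ hA => h.isPeriodicPatchPair hA⟩
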